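/- Let $\Bbbk$ be any field of prime characteristic $p$, and let $\mathrm{Vect}$ be the category of $\Bbbk$-vector spaces. A restricted Lie algebra over $\Bbbk$ is a Lie algebra $L$ with a map $x\mapsto x^{[p]}$ such that $(\alpha x)^{[p]}=\alpha^p x^{[p]}$, $\mathrm{ad}(x^{[p]})=\mathrm{ad}(x)^p$ and $(x+y)^{[p]}=x^{[p]}+y^{[p]}+\sum_{i=1}^{p-1}\frac{s_i(x,y)}{i}$, where $s_i(x,y)$ is the coefficient of $\beta^{i-1}$ in $\mathrm{ad}(\beta x+y)^{p-1}(x)$. Let $\mathsf{Lie}_p$ be the category of restricted Lie algebras and Lie algebra morphisms commuting with the maps $(-)^{[p]}$, and $H:\mathsf{Lie}_p\to\mathrm{Vect}$ the forgetful functor. For a $\Bbbk$-bialgebra $B$ let $P(B)=\{x\in B:\Delta(x)=x\otimes 1+1\otimes x\}$, and let $\mathcal P(B)$ be $P(B)$ with $[x,y]=xy-yx$ and $x^{[p]}=x^p$, so that $H\mathcal P=P$. Let $\widetilde T:\mathrm{Vect}\to\mathsf{Bialg}$ send $V$ to its tensor algebra with all $v\in V$ primitive; it is left adjoint to $P$,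 with unit $\widetilde\eta_V:V\to P\widetilde TV$, $v\mapsto v$. Let $\widetilde{\mathfrak u}:\mathsf{Lie}_p\to\mathsf{Bialg}$ be the restricted universal enveloping algebra functor (the quotient of the universal enveloping algebra by the ideal generated by the $x^p-x^{[p]}$, $x\in L$, with $L$ primitive); it is left adjoint to $\mathcal P$, with unit $\widetilde\eta_{\mathrm L}$. Let $\zeta_{11}:\widetilde TH\to\widetilde{\mathfrak u}$ be the natural transformation whose component at $L$ is the bialgebra morphism $\widetilde TL\to\widetilde{\mathfrak u}L$ that restricts to the canonical map on $L$. Then: 1. For every vector space $V$, $\mathcal P\widetilde TV=(P\widetilde TV,[-,-],(-)^{[p]})$ with $[x,y]=x\otimes y-y\otimes x$ and $x^{[p]}=x^{\otimes p}$ for $x,y\in P\widetilde TV$. 2. $H\mathcal P=P$, and $\zeta_{11}$ is the transpose (mate), with respect to the adjunctions $(\widetilde{\mathfrak u},\mathcal P)$ and $(\widetilde T,P)$, of the identity of $H\mathcal P=P$. 3. $\widetilde\eta_{\mathrm L}:\mathrm{id}\to\mathcal P\widetilde{\mathfrak u}$ is an isomorphism, and $\mathcal P\widetilde T$ is left adjoint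 to $H$, with unit $\widetilde\eta$ and counit $\widetilde\eta_{\mathrm L}^{-1}\circ\mathcal P\zeta_{11}$. 4. Consequently $\mathcal P\widetilde TV$ is the free restricted Lie algebra on $V$: for every restricted Lie algebra $L$, every linear map $f:V\to L$ extends uniquely along $v\mapsto v$ to a morphism of restricted Lie algebras $\mathcal P\widetilde TV\to L$. -/

import Mathlib

universe u v

open CategoryTheory Polynomial
open scoped TensorProduct

attribute [local instance 100] LieRing.ofAssociativeRing

noncomputable section

namespace RestrictedLie

section Definitions

variable (k : Type*) [Field k] {L : Type*} [LieRing L] [LieAlgebra k L]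

/-- `jacobsonTerm k p i x y` is the coefficient of `β ^ (i - 1)` in the expansion of
`(ad (β x + y)) ^ (p - 1) (x)`, where `β` is a central indeterminate, so that
`ad (β x + y) = β ad x + ad y` is a polynomial with coefficients in `End L`. -/
def jacobsonTerm (p i : ℕ) (x y : L) : L :=
  (((C (LieAlgebra.ad k L x) * X + C (LieAlgebra.ad k L y) : (Module.End k L)[X])
    ^ (p - 1)).coeff (i - 1)) x

/-- `s(x, y) = ∑_{i = 1}^{p - 1} s_i(x, y) / i`. -/
def jacobsonSum (p : ℕ) (x y : L) : L :=
  ∑ i ∈ Finset.Icc 1 (p - 1), ((i : k)⁻¹) • jacobsonTerm k p i x y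

end Definitions

/-- A restricted Lie algebra structure (in characteristic `p`) on the Lie algebra `L` over `k`. -/
class RestrictedLieAlgebra (k : Type*) (p : ℕ) (L : Type*) [Field k] [LieRing L]
    [LieAlgebra k L] where
  /-- The map `x ↦ x^{[p]}`. -/
  pMap : L → L
  pMap_smul (a : k) (x : L) : pMap (a • x) = a ^ p • pMap x
  ad_pMap (x : L) : LieAlgebra.ad k L (pMap x) = LieAlgebra.ad k L x ^ p
  pMap_add (x y : L) : pMap (x + y) = pMap x + pMap y + jacobsonSum k p x y


/-- The `p`-map `x ↦ x^{[p]}` of a restricted Lie algebra. -/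
abbrev pPow (k : Type*) (p : ℕ) {L : Type*} [Field k] [LieRing L] [LieAlgebra k L]
    [RestrictedLieAlgebra k p L] (x : L) : L :=
  RestrictedLieAlgebra.pMap (k := k) (p := p) x

/-- Morphisms of restricted Lie algebras: Lie algebra morphisms commuting with the `p`-maps. -/
@[ext]
structure RestrictedLieHom (k : Type*) (p : ℕ) (L M : Type*) [Field k] [LieRing L]
    [LieAlgebra k L] [RestrictedLieAlgebra k p L] [LieRing M] [LieAlgebra k M]
    [RestrictedLieAlgebra k p M] where
  /-- The underlying morphism of Lie algebras. -/
  toLieHom : L →ₗ⁅k⁆ M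
  map_pPow (x : L) : toLieHom (pPow k p x) = pPow k p (toLieHom x)

/-- The identity morphism of a restricted Lie algebra. -/
def RestrictedLieHom.id (k : Type*) (p : ℕ) (L : Type*) [Field k] [LieRing L] [LieAlgebra k L]
    [RestrictedLieAlgebra k p L] : RestrictedLieHom k p L L :=
  ⟨LieHom.id, fun _ => rfl⟩

/-- Composition of morphisms of restricted Lie algebras. -/
def RestrictedLieHom.comp {k : Type*} {p : ℕ} {L M N : Type*} [Field k] [LieRing L]
    [LieAlgebra k L] [RestrictedLieAlgebra k p L] [LieRing M] [LieAlgebra k M]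
    [RestrictedLieAlgebra k p M] [LieRing N] [LieAlgebra k N] [RestrictedLieAlgebra k p N]
    (g : RestrictedLieHom k p M N) (f : RestrictedLieHom k p L M) : RestrictedLieHom k p L N :=
  ⟨g.toLieHom.comp f.toLieHom, fun x => by
    rw [LieHom.comp_apply, LieHom.comp_apply, f.map_pPow, g.map_pPow]⟩

/-- The category `Lie_p` of restricted Lie algebras over `k`. -/
structure LieP (k : Type u) [Field k] (p : ℕ) where
  /-- The underlying type. -/
  carrier : Type v
  [instLieRing : LieRing carrier]
  [instLieAlgebra : LieAlgebra k carrier]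
  [instRestricted : RestrictedLieAlgebra k p carrier]

attribute [instance] LieP.instLieRing LieP.instLieAlgebra LieP.instRestricted

instance LieP.instCoeSort (k : Type u) [Field k] (p : ℕ) : CoeSort (LieP.{u, v} k p) (Type v) :=
  ⟨LieP.carrier⟩

instance LieP.instCategory (k : Type u) [Field k] (p : ℕ) : Category (LieP.{u, v} k p) where
  Hom L M := RestrictedLieHom k p L M
  id L := RestrictedLieHom.id k p L
  comp f g := RestrictedLieHom.comp g f

/-- The forgetful functor `H : Lie_p ⥤ Vect`. -/
def forgetLieP (k : Type u) [Field k] (p : ℕ) : LieP.{u, v} k p ⥤ ModuleCat.{v} k where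
  obj L := ModuleCat.of k L
  map f := ModuleCat.ofHom (RestrictedLieHom.toLieHom f : _ →ₗ[k] _)

section Jacobson

lemma jacobsonCoeff_map {k : Type*} [Field k] {L M : Type*} [LieRing L] [LieAlgebra k L]
    [LieRing M] [LieAlgebra k M] (f : L →ₗ⁅k⁆ M) (x y z : L) (n i : ℕ) :
    f ((((C (LieAlgebra.ad k L x) * X + C (LieAlgebra.ad k L y) : (Module.End k L)[X])
      ^ n).coeff i) z) =
    (((C (LieAlgebra.ad k M (f x)) * X + C (LieAlgebra.ad k M (f y)) : (Module.End k M)[X])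
      ^ n).coeff i) (f z) := by
  induction n generalizing i with
  | zero =>
    simp only [pow_zero, coeff_one]
    split_ifs <;> simp
  | succ n ih =>
    rw [pow_succ', pow_succ', add_mul, add_mul, coeff_add, coeff_add, mul_assoc, mul_assoc,
      coeff_C_mul, coeff_C_mul, coeff_C_mul, coeff_C_mul]
    cases i with
    | zero => simp [ih]
    | succ i => simp [coeff_X_mul, ih]

lemma map_jacobsonSum {k : Type*} [Field k] {L M : Type*} [LieRing L] [LieAlgebra k L]
    [LieRing M] [LieAlgebra k M] (f : L →ₗ⁅k⁆ M) (p : ℕ) (x y : L) :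
    f (jacobsonSum k p x y) = jacobsonSum k p (f x) (f y) := by
  simp only [jacobsonSum, jacobsonTerm, map_sum, map_smul, jacobsonCoeff_map]

lemma cast_choose_pred (p : ℕ) (hp : p.Prime) {E : Type*} [Ring E] (hE : (p : E) = 0)
    (i : ℕ) (hi : i < p) : (((p - 1).choose i : ℕ) : E) = (-1) ^ i := by
  induction i with
  | zero => simp
  | succ i ih =>
    have h1 : (p - 1).choose i + (p - 1).choose (i + 1) = p.choose (i + 1) := by
      conv_rhs => rw [← Nat.sub_add_cancel hp.one_le]
      rw [Nat.choose_succ_succ]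
    have h2 : ((p.choose (i + 1) : ℕ) : E) = 0 := by
      obtain ⟨c, hc⟩ := hp.dvd_choose_self (Nat.succ_ne_zero i) hi
      rw [hc, Nat.cast_mul, hE, zero_mul]
    rw [← h1, Nat.cast_add, ih (by omega)] at h2
    rw [pow_succ, mul_neg_one]
    exact eq_neg_of_add_eq_zero_right h2

lemma sub_pow_pred (p : ℕ) (hp : p.Prime) {E : Type*} [Ring E] (hE : (p : E) = 0)
    (a b : E) (h : Commute a b) :
    (a - b) ^ (p - 1) = ∑ i ∈ Finset.range p, a ^ i * b ^ (p - 1 - i) := by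
  have h' : Commute (-b) a := h.symm.neg_left
  rw [sub_eq_add_neg, add_comm, h'.add_pow, Nat.sub_add_cancel hp.one_le,
    ← Finset.sum_range_reflect]
  refine Finset.sum_congr rfl fun i hi => ?_
  have hi' : i < p := Finset.mem_range.1 hi
  have h3 : p - 1 - (p - 1 - i) = i := by omega
  have h4 : ((-1 : E)) ^ (p - 1 - i) * (-1) ^ (p - 1 - i) = 1 := by
    rw [← pow_add, ← two_mul, pow_mul]; simp
  have h5 : Commute ((-1 : E) ^ (p - 1 - i)) (b ^ (p - 1 - i) * a ^ i) :=
    (Commute.neg_one_left _).pow_left _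
  rw [h3, cast_choose_pred p hp hE _ (by omega), neg_pow b, mul_assoc, mul_assoc, ← mul_assoc (b ^ _),
    ← h5.eq, ← mul_assoc, h4, one_mul, (h.pow_pow i (p - 1 - i)).eq]

lemma cast_end_eq_zero (p : ℕ) {A : Type*} [Ring A] (hA : (p : A) = 0) :
    (p : Module.End ℤ A) = 0 := by
  ext a
  simp [Module.End.natCast_apply, ← Nat.cast_smul_eq_nsmul A, hA]

lemma ad_pow_prime (k : Type*) [Field k] (p : ℕ) (hp : p.Prime) {A : Type*} [Ring A]
    [Algebra k A] (hA : (p : A) = 0) (x : A) :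
    LieAlgebra.ad k A (x ^ p) = LieAlgebra.ad k A x ^ p := by
  have hE : (p : Module.End k A) = 0 := by
    ext a
    simp [Module.End.natCast_apply, ← Nat.cast_smul_eq_nsmul A, hA]
  have hc := LinearMap.commute_mulLeft_right (R := k) x x
  have hs := sub_pow_pred p hp hE _ _ hc
  have h1 := hc.geom_sum₂_mul p
  rw [← hs, ← pow_succ, Nat.sub_add_cancel hp.one_le, LinearMap.pow_mulLeft,
    LinearMap.pow_mulRight] at h1
  have h2 : LieAlgebra.ad k A x = LinearMap.mulLeft k x - LinearMap.mulRight k x := by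
    ext a; simp [LieRing.of_associative_ring_bracket]
  rw [h2, h1]
  ext a; simp [LieRing.of_associative_ring_bracket]

lemma derivative_pow_noncomm {A : Type*} [Ring A] (q : A[X]) (n : ℕ) :
    derivative (q ^ n) = ∑ i ∈ Finset.range n, q ^ i * derivative q * q ^ (n - 1 - i) := by
  induction n with
  | zero => simp
  | succ n ih =>
    rw [pow_succ, derivative_mul, ih, Finset.sum_range_succ, Finset.sum_mul]
    congr 1
    · refine Finset.sum_congr rfl fun i hi => ?_
      have hi' : i < n := Finset.mem_range.1 hi
      rw [mul_assoc, ← pow_succ]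
      congr 2
      omega
    · simp

lemma coeff_jacobson (k : Type*) [Field k] {A : Type*} [Ring A] [Algebra k A] (x y z : A)
    (n i : ℕ) :
    (((C (LieAlgebra.ad k A x) * X + C (LieAlgebra.ad k A y) : (Module.End k A)[X])
      ^ n).coeff i) z =
    (((LinearMap.mulLeft ℤ (C x * X + C y : A[X]) -
      LinearMap.mulRight ℤ (C x * X + C y : A[X])) ^ n) (C z)).coeff i := by
  induction n generalizing i with
  | zero =>
    simp only [pow_zero, coeff_one, Module.End.one_apply, coeff_C]
    split_ifs <;> simp
  | succ n ih =>
    rw [pow_succ', pow_succ', Module.End.mul_apply, LinearMap.sub_apply, LinearMap.mulLeft_apply,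
      LinearMap.mulRight_apply, coeff_sub, add_mul, mul_add, add_mul, coeff_add, coeff_add,
      coeff_add, mul_assoc, mul_assoc, coeff_C_mul, coeff_C_mul, coeff_C_mul, coeff_C_mul,
      ← mul_assoc _ (C x) X, coeff_mul_C]
    cases i with
    | zero => simp [ih, LieRing.of_associative_ring_bracket]
    | succ i =>
      simp only [coeff_X_mul, coeff_mul_X, LinearMap.add_apply, Module.End.mul_apply, ih,
        LieAlgebra.ad_apply, LieRing.of_associative_ring_bracket, coeff_mul_C]
      abel

/-- Jacobson's formula in an associative algebra of characteristic `p`. -/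
lemma jacobson_add_pow (k : Type*) [Field k] (p : ℕ) (hp : p.Prime) [CharP k p] {A : Type*}
    [Ring A] [Algebra k A] (x y : A) :
    (x + y) ^ p = x ^ p + y ^ p + jacobsonSum k p x y := by
  have hA : (p : A) = 0 := by
    rw [← map_natCast (algebraMap k A), CharP.cast_eq_zero, map_zero]
  have hAX : (p : A[X]) = 0 := by
    rw [← map_natCast (C : A →+* A[X]), hA, map_zero]
  set P : A[X] := C x * X + C y with hP
  have hd : derivative (P ^ p) =
      ((LinearMap.mulLeft ℤ P - LinearMap.mulRight ℤ P) ^ (p - 1)) (C x) := by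
    rw [derivative_pow_noncomm, sub_pow_pred p hp (cast_end_eq_zero p hAX) _ _
      (LinearMap.commute_mulLeft_right (R := ℤ) P P)]
    simp [hP, LinearMap.pow_mulLeft, LinearMap.pow_mulRight, mul_assoc]
  have hi : ∀ i ∈ Finset.Icc 1 (p - 1),
      ((i : k)⁻¹) • jacobsonTerm k p i x y = (P ^ p).coeff i := by
    intro i hi
    obtain ⟨h1, h2⟩ := Finset.mem_Icc.1 hi
    have h0 : (i : k) ≠ 0 := by
      rw [Ne, CharP.cast_eq_zero_iff k p]
      intro hdvd
      have := Nat.le_of_dvd h1 hdvd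
      have := hp.one_le
      omega
    have h3 : jacobsonTerm k p i x y = (i : k) • (P ^ p).coeff i := by
      rw [jacobsonTerm, coeff_jacobson, ← hP, ← hd, coeff_derivative]
      have h4 : ((i - 1 : ℕ) : A) + 1 = (i : A) := by
        rw [← Nat.cast_succ, Nat.succ_eq_add_one, Nat.sub_add_cancel h1]
      rw [h4, Nat.sub_add_cancel h1, Nat.cast_smul_eq_nsmul, nsmul_eq_mul, Nat.cast_comm]
    rw [h3, smul_smul, inv_mul_cancel₀ h0, one_smul]
  have hdeg : P.natDegree ≤ 1 := natDegree_linear_le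
  have hdegp : (P ^ p).natDegree < p + 1 :=
    Nat.lt_succ_of_le ((natDegree_pow_le_of_le p hdeg).trans (by simp))
  have hev : (P ^ p).eval 1 = (x + y) ^ p := by
    have h := map_pow (eval₂RingHom' (RingHom.id A) 1 fun a => Commute.one_right _) P p
    have h' : ∀ q : A[X], eval₂RingHom' (RingHom.id A) 1 (fun a => Commute.one_right _) q
        = q.eval 1 := fun q => rfl
    rw [h', h'] at h
    rw [h, hP]
    simp
  have h0 : (P ^ p).coeff 0 = y ^ p := by
    have h := map_pow (constantCoeff : A[X] →+* A) P p
    simpa [hP] using h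
  have hpp : (P ^ p).coeff p = x ^ p := by
    have h := coeff_pow_of_natDegree_le (m := p) hdeg
    simpa [hP] using h
  have hsum : (P ^ p).eval 1 = ∑ i ∈ Finset.range (p + 1), (P ^ p).coeff i := by
    rw [eval_eq_sum_range' hdegp]; simp
  have hIcc : Finset.Icc 1 (p - 1) = Finset.Ico 1 p := by
    ext i
    have := hp.one_le
    simp only [Finset.mem_Icc, Finset.mem_Ico]
    omega
  rw [← hev, hsum, Finset.sum_range_succ, Finset.range_eq_Ico,
    Finset.sum_eq_sum_Ico_succ_bot hp.pos, h0, hpp, jacobsonSum, Finset.sum_congr rfl hi, hIcc]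
  abel

end Jacobson
section Primitive

/-- The primitive elements `P(B) = {x | Δ x = x ⊗ 1 + 1 ⊗ x}` of a bialgebra `B`; they are closed
under the commutator bracket. -/
def primitives (k B : Type*) [Field k] [Ring B] [Bialgebra k B] : LieSubalgebra k B where
  carrier := {x | Coalgebra.comul (R := k) x = x ⊗ₜ[k] 1 + 1 ⊗ₜ[k] x}
  zero_mem' := by simp
  add_mem' {x y} hx hy := by
    change Coalgebra.comul (R := k) _ = _ at hx hy ⊢
    rw [map_add, hx, hy, TensorProduct.add_tmul, TensorProduct.tmul_add]
    abel
  smul_mem' a x hx := by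
    change Coalgebra.comul (R := k) _ = _ at hx ⊢
    rw [map_smul, hx, smul_add, TensorProduct.smul_tmul', TensorProduct.tmul_smul]
  lie_mem' {x y} hx hy := by
    change Coalgebra.comul (R := k) _ = _ at hx hy ⊢
    rw [LieRing.of_associative_ring_bracket, map_sub, Bialgebra.comul_mul, Bialgebra.comul_mul,
      hx, hy]
    simp only [add_mul, mul_add, Algebra.TensorProduct.tmul_mul_tmul, one_mul, mul_one,
      TensorProduct.sub_tmul, TensorProduct.tmul_sub]
    abel

lemma mem_primitives {k B : Type*} [Field k] [Ring B] [Bialgebra k B] {x : B} :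
    x ∈ primitives k B ↔ Coalgebra.comul (R := k) x = x ⊗ₜ[k] 1 + 1 ⊗ₜ[k] x := Iff.rfl

lemma pow_mem_primitives {k : Type*} [Field k] (p : ℕ) [Fact p.Prime] [CharP k p] {B : Type*}
    [Ring B] [Bialgebra k B] {x : B} (hx : x ∈ primitives k B) : x ^ p ∈ primitives k B := by
  rw [mem_primitives] at hx ⊢
  have hp : p.Prime := Fact.out
  have hz : (p : B ⊗[k] B) = 0 := by
    rw [← map_natCast (algebraMap k (B ⊗[k] B)), CharP.cast_eq_zero, map_zero]
  have hc : Commute (x ⊗ₜ[k] (1 : B)) ((1 : B) ⊗ₜ[k] x) := by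
    simp [commute_iff_eq, Algebra.TensorProduct.tmul_mul_tmul]
  obtain ⟨r, hr⟩ := hc.exists_add_pow_prime_eq hp
  rw [Bialgebra.comul_pow, hx, hr, hz]
  simp [Algebra.TensorProduct.tmul_pow]

/-- The primitive elements of a bialgebra over a field of characteristic `p` form a restricted Lie
algebra, with `[x, y] = x y - y x` and `x^{[p]} = x ^ p`. -/
instance primitivesRestricted (k : Type*) [Field k] (p : ℕ) [Fact p.Prime] [CharP k p] (B : Type*)
    [Ring B] [Bialgebra k B] : RestrictedLieAlgebra k p (primitives k B) where
  pMap x := ⟨(x : B) ^ p, pow_mem_primitives p x.2⟩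
  pMap_smul a x := Subtype.ext (by simp [_root_.smul_pow])
  ad_pMap x := by
    have hB : (p : B) = 0 := by
      rw [← map_natCast (algebraMap k B), CharP.cast_eq_zero, map_zero]
    ext y
    rw [LieSubalgebra.coe_ad_pow, LieSubalgebra.coe_ad, ad_pow_prime k p Fact.out hB]
  pMap_add x y := Subtype.ext (by
    have h := map_jacobsonSum (primitives k B).incl p x y
    have h' := jacobson_add_pow k p Fact.out (x : B) (y : B)
    simp only [LieSubalgebra.coe_incl] at h
    simp [h, h'])

/-- The Lie algebra morphism `P(B) → P(B')` induced by a bialgebra morphism `B → B'`. -/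
def primitivesMap {k B B' : Type*} [Field k] [Ring B] [Bialgebra k B] [Ring B'] [Bialgebra k B']
    (f : B →ₐc[k] B') : primitives k B →ₗ⁅k⁆ primitives k B' where
  toFun x := ⟨f x, by
    have hx := mem_primitives.1 x.2
    rw [mem_primitives, ← CoalgHomClass.map_comp_comul_apply, hx]
    simp⟩
  map_add' x y := Subtype.ext (by simp)
  map_smul' a x := Subtype.ext (by simp)
  map_lie' {x y} := Subtype.ext (by simp [LieRing.of_associative_ring_bracket])

/-- The functor `P : Bialg ⥤ Vect` of primitive elements. -/
def primitiveSpaceFunctor (k : Type u) [Field k] : BialgCat.{v} k ⥤ ModuleCat.{v} k where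
  obj B := ModuleCat.of k (primitives k B)
  map f := ModuleCat.ofHom (primitivesMap f.toBialgHom : _ →ₗ[k] _)

/-- The morphism of restricted Lie algebras `𝒫 B → 𝒫 B'` induced by a bialgebra morphism. -/
def restrictedPrimitivesMap {k : Type*} [Field k] (p : ℕ) [Fact p.Prime] [CharP k p] {B B' : Type*}
    [Ring B] [Bialgebra k B] [Ring B'] [Bialgebra k B'] (f : B →ₐc[k] B') :
    RestrictedLieHom k p (primitives k B) (primitives k B') where
  toLieHom := primitivesMap f
  map_pPow x := Subtype.ext (map_pow f (x : B) p)

/-- The functor `𝒫 : Bialg ⥤ Lie_p` of restricted primitive elements. -/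
def primitiveFunctor (k : Type u) [Field k] (p : ℕ) [Fact p.Prime] [CharP k p] :
    BialgCat.{v} k ⥤ LieP.{u, v} k p where
  obj B := ⟨primitives k B⟩
  map f := restrictedPrimitivesMap p f.toBialgHom

end Primitive

section Tensor

open TensorAlgebra in
/-- The tensor bialgebra `T̃ V`: the tensor algebra of `V`, in which every `v : V` is primitive. -/
instance tensorBialgebra (k V : Type*) [Field k] [AddCommGroup V] [Module k V] :
    Bialgebra k (TensorAlgebra k V) :=
  .ofAlgHom
    (lift k ((TensorProduct.mk k _ _).flip 1 ∘ₗ ι k + TensorProduct.mk k _ _ 1 ∘ₗ ι k))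
    algebraMapInv
    (by
      ext x
      simp [Algebra.TensorProduct.one_def, TensorProduct.add_tmul, TensorProduct.tmul_add]
      abel)
    (by ext x; simp [algebraMapInv])
    (by ext x; simp [algebraMapInv])

lemma tensor_comul_ι (k : Type*) {V : Type*} [Field k] [AddCommGroup V] [Module k V] (v : V) :
    Coalgebra.comul (R := k) (TensorAlgebra.ι k v) =
      TensorAlgebra.ι k v ⊗ₜ[k] 1 + 1 ⊗ₜ[k] TensorAlgebra.ι k v :=
  TensorAlgebra.lift_ι_apply _ v

lemma tensor_counit_ι (k : Type*) {V : Type*} [Field k] [AddCommGroup V] [Module k V] (v : V) :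
    Coalgebra.counit (R := k) (TensorAlgebra.ι k v) = 0 :=
  TensorAlgebra.lift_ι_apply _ v

lemma ι_mem_primitives (k : Type*) {V : Type*} [Field k] [AddCommGroup V] [Module k V] (v : V) :
    TensorAlgebra.ι k v ∈ primitives k (TensorAlgebra k V) :=
  tensor_comul_ι k v

lemma counit_eq_zero_of_mem_primitives {k B : Type*} [Field k] [Ring B] [Bialgebra k B] {x : B}
    (hx : x ∈ primitives k B) : Coalgebra.counit (R := k) x = 0 := by
  have h := congrArg (TensorProduct.lid k B) (Coalgebra.rTensor_counit_comul (R := k) x)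
  rw [mem_primitives.1 hx, map_add, LinearMap.rTensor_tmul, LinearMap.rTensor_tmul, map_add,
    TensorProduct.lid_tmul, TensorProduct.lid_tmul, TensorProduct.lid_tmul, Bialgebra.counit_one,
    one_smul, add_eq_right] at h
  simpa using congrArg (Coalgebra.counit (R := k)) h

/-- The bialgebra morphism `T̃ V → B` extending a linear map from `V` to the primitives of `B`. -/
def tensorLift {k V B : Type*} [Field k] [AddCommGroup V] [Module k V] [Ring B] [Bialgebra k B]
    (f : V →ₗ[k] primitives k B) : TensorAlgebra k V →ₐc[k] B :=
  .ofAlgHom (TensorAlgebra.lift k ((primitives k B).toSubmodule.subtype ∘ₗ f))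
    (by
      ext v
      simpa [tensor_counit_ι] using counit_eq_zero_of_mem_primitives (f v).2)
    (by
      ext v
      have h := mem_primitives.1 (f v).2
      simp [tensor_comul_ι, h])

@[simp]
lemma tensorLift_ι {k V B : Type*} [Field k] [AddCommGroup V] [Module k V] [Ring B] [Bialgebra k B]
    (f : V →ₗ[k] primitives k B) (v : V) : tensorLift f (TensorAlgebra.ι k v) = f v :=
  TensorAlgebra.lift_ι_apply _ v

lemma tensor_bialgHom_ext {k V B : Type*} [Field k] [AddCommGroup V] [Module k V] [Ring B]
    [Bialgebra k B] {f g : TensorAlgebra k V →ₐc[k] B}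
    (h : ∀ v, f (TensorAlgebra.ι k v) = g (TensorAlgebra.ι k v)) : f = g := by
  have h' : (f : TensorAlgebra k V →ₐ[k] B) = (g : TensorAlgebra k V →ₐ[k] B) :=
    TensorAlgebra.hom_ext (LinearMap.ext h)
  exact BialgHom.ext fun x => DFunLike.congr_fun h' x

/-- The inclusion of `V` into the primitive elements of `T̃ V`. -/
def tensorUnit (k V : Type*) [Field k] [AddCommGroup V] [Module k V] :
    V →ₗ[k] primitives k (TensorAlgebra k V) where
  toFun v := ⟨TensorAlgebra.ι k v, ι_mem_primitives k v⟩
  map_add' v w := Subtype.ext (by simp)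
  map_smul' a v := Subtype.ext (by simp)

lemma tensorLift_comp {k V W B : Type*} [Field k] [AddCommGroup V] [Module k V] [AddCommGroup W]
    [Module k W] [Ring B] [Bialgebra k B] (g : W →ₗ[k] primitives k B) (f : V →ₗ[k] W) :
    (tensorLift g).comp (tensorLift (tensorUnit k W ∘ₗ f)) = tensorLift (g ∘ₗ f) :=
  tensor_bialgHom_ext fun v => by
    rw [BialgHom.comp_apply, tensorLift_ι, tensorLift_ι]
    exact tensorLift_ι g (f v)

lemma comp_tensorLift {k V B B' : Type*} [Field k] [AddCommGroup V] [Module k V] [Ring B]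
    [Bialgebra k B] [Ring B'] [Bialgebra k B'] (g : B →ₐc[k] B') (f : V →ₗ[k] primitives k B) :
    g.comp (tensorLift f) = tensorLift ((primitivesMap g : _ →ₗ[k] _) ∘ₗ f) :=
  tensor_bialgHom_ext fun v => by
    rw [BialgHom.comp_apply, tensorLift_ι, tensorLift_ι]
    rfl

lemma tensorLift_tensorUnit (k V : Type*) [Field k] [AddCommGroup V] [Module k V] :
    tensorLift (tensorUnit k V) = BialgHom.id k (TensorAlgebra k V) :=
  tensor_bialgHom_ext fun v => tensorLift_ι _ v

lemma tensorLift_id_natural {k B B' : Type*} [Field k] [Ring B] [Bialgebra k B] [Ring B']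
    [Bialgebra k B'] (g : B →ₐc[k] B') :
    (tensorLift (LinearMap.id : primitives k B' →ₗ[k] _)).comp
        (tensorLift (tensorUnit k (primitives k B') ∘ₗ (primitivesMap g : _ →ₗ[k] _))) =
      g.comp (tensorLift (LinearMap.id : primitives k B →ₗ[k] _)) := by
  rw [tensorLift_comp, comp_tensorLift, LinearMap.id_comp, LinearMap.comp_id]

lemma tensorLift_id_triangle (k V : Type*) [Field k] [AddCommGroup V] [Module k V] :
    (tensorLift (LinearMap.id : primitives k (TensorAlgebra k V) →ₗ[k] _)).comp
        (tensorLift (tensorUnit k (primitives k (TensorAlgebra k V)) ∘ₗ tensorUnit k V)) =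
      BialgHom.id k (TensorAlgebra k V) := by
  rw [tensorLift_comp, LinearMap.id_comp, tensorLift_tensorUnit]

/-- The functor `T̃ : Vect ⥤ Bialg`. -/
def tensorFunctor (k : Type u) [Field k] : ModuleCat.{v} k ⥤ BialgCat.{max u v} k where
  obj V := BialgCat.of k (TensorAlgebra k V)
  map {_ W} f := BialgCat.ofHom (tensorLift (tensorUnit k W ∘ₗ f.hom))
  map_id V := BialgCat.hom_ext _ _ (tensorLift_tensorUnit k V)
  map_comp {_ _ Z} f g := BialgCat.hom_ext _ _
    (tensorLift_comp (tensorUnit k Z ∘ₗ g.hom) f.hom).symm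

/-- The adjunction `T̃ ⊣ P`, whose unit `η̃_V : V → P(T̃ V)` is the inclusion of generators. -/
def tensorAdjunction (k : Type u) [Field k] :
    tensorFunctor.{u, max u v} k ⊣ primitiveSpaceFunctor.{u, max u v} k where
  unit :=
    { app := fun V => ModuleCat.ofHom (tensorUnit k V)
      naturality := fun _ W f => ModuleCat.hom_ext (LinearMap.ext fun v => Subtype.ext
        (tensorLift_ι (tensorUnit k W ∘ₗ f.hom) v).symm) }
  counit :=
    { app := fun B => BialgCat.ofHom (tensorLift (LinearMap.id : primitives k B →ₗ[k] _))
      naturality := fun _ _ f => BialgCat.hom_ext _ _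
        (tensorLift_id_natural f.toBialgHom) }
  left_triangle_components V := congrArg
    (BialgCat.ofHom (X := TensorAlgebra k V) (Y := TensorAlgebra k V)) (tensorLift_id_triangle k V)
  right_triangle_components _ := ModuleCat.hom_ext (LinearMap.ext fun v => Subtype.ext
    (tensorLift_ι _ v))

end Tensor

section Enveloping

/-- The relations `x ^ p = x^{[p]}`, for `x` in `L`, in the universal enveloping algebra of `L`. -/
inductive EnvelopingRel (k : Type*) (p : ℕ) (L : Type*) [Field k] [LieRing L] [LieAlgebra k L]
    [RestrictedLieAlgebra k p L] :
    UniversalEnvelopingAlgebra k L → UniversalEnvelopingAlgebra k L → Prop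
  | pow (x : L) : EnvelopingRel k p L
      (UniversalEnvelopingAlgebra.ι k x ^ p) (UniversalEnvelopingAlgebra.ι k (pPow k p x))

/-- The restricted universal enveloping algebra of `L`: the quotient of the universal enveloping
algebra by the ideal generated by the elements `x ^ p - x^{[p]}`. -/
def RestrictedEnveloping (k : Type*) (p : ℕ) (L : Type*) [Field k] [LieRing L]
    [LieAlgebra k L] [RestrictedLieAlgebra k p L] :=
  RingQuot (EnvelopingRel k p L)

namespace RestrictedEnveloping

instance instRing (k : Type*) (p : ℕ) (L : Type*) [Field k] [LieRing L] [LieAlgebra k L]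
    [RestrictedLieAlgebra k p L] : Ring (RestrictedEnveloping k p L) :=
  inferInstanceAs (Ring (RingQuot (EnvelopingRel k p L)))

instance instAlgebra (k : Type*) (p : ℕ) (L : Type*) [Field k] [LieRing L] [LieAlgebra k L]
    [RestrictedLieAlgebra k p L] : Algebra k (RestrictedEnveloping k p L) :=
  inferInstanceAs (Algebra k (RingQuot (EnvelopingRel k p L)))

/-- The quotient map from the universal enveloping algebra. -/
def mk (k : Type*) (p : ℕ) (L : Type*) [Field k] [LieRing L] [LieAlgebra k L]
    [RestrictedLieAlgebra k p L] :
    UniversalEnvelopingAlgebra k L →ₐ[k] RestrictedEnveloping k p L :=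
  RingQuot.mkAlgHom k (EnvelopingRel k p L)

variable (k : Type*) (p : ℕ) {L : Type*} [Field k] [LieRing L] [LieAlgebra k L]
  [RestrictedLieAlgebra k p L]

/-- The canonical map from `L` to its restricted universal enveloping algebra. -/
def ι : L →ₗ⁅k⁆ RestrictedEnveloping k p L :=
  (mk k p L).toLieHom.comp (UniversalEnvelopingAlgebra.ι k)

lemma ι_pPow (x : L) : ι k p (pPow k p x) = ι k p x ^ p := by
  have h : mk k p L _ = mk k p L _ :=
    RingQuot.mkAlgHom_rel k (EnvelopingRel.pow (k := k) (p := p) x)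
  rw [map_pow] at h
  exact h.symm

variable {k p} {A : Type*} [Ring A] [Algebra k A]

/-- The universal property of the restricted universal enveloping algebra. -/
def lift (f : L →ₗ⁅k⁆ A) (hf : ∀ x, f (pPow k p x) = f x ^ p) : RestrictedEnveloping k p L →ₐ[k] A :=
  RingQuot.liftAlgHom k ⟨UniversalEnvelopingAlgebra.lift k f, by
    rintro _ _ ⟨x⟩
    rw [map_pow, UniversalEnvelopingAlgebra.lift_ι_apply, UniversalEnvelopingAlgebra.lift_ι_apply,
      hf]⟩

@[simp]
lemma lift_ι (f : L →ₗ⁅k⁆ A) (hf : ∀ x, f (pPow k p x) = f x ^ p) (x : L) :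
    lift f hf (ι k p x) = f x :=
  (RingQuot.liftAlgHom_mkAlgHom_apply ..).trans (UniversalEnvelopingAlgebra.lift_ι_apply k f x)

lemma algHom_ext {f g : RestrictedEnveloping k p L →ₐ[k] A}
    (h : ∀ x, f (ι k p x) = g (ι k p x)) : f = g :=
  RingQuot.ringQuot_ext' k _ _ (UniversalEnvelopingAlgebra.hom_ext k (LieHom.ext h))

variable (k p L)

/-- The counit of the restricted universal enveloping algebra. -/
def counitHom [Fact p.Prime] : RestrictedEnveloping k p L →ₐ[k] k :=
  lift 0 fun x => by
    simp [(Fact.out : p.Prime).ne_zero]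

@[simp]
lemma counitHom_ι [Fact p.Prime] (x : L) : counitHom k p L (ι k p x) = 0 :=
  lift_ι _ _ x

variable [Fact p.Prime] [CharP k p]

/-- The comultiplication of the restricted universal enveloping algebra. -/
def comulHom : RestrictedEnveloping k p L →ₐ[k]
    RestrictedEnveloping k p L ⊗[k] RestrictedEnveloping k p L :=
  lift
    { toFun := fun x => ι k p x ⊗ₜ[k] 1 + 1 ⊗ₜ[k] ι k p x
      map_add' := fun x y => by
        rw [map_add, TensorProduct.add_tmul, TensorProduct.tmul_add]
        abel
      map_smul' := fun a x => by
        rw [map_smul, RingHom.id_apply, smul_add, TensorProduct.smul_tmul',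
          TensorProduct.tmul_smul]
      map_lie' := fun {x y} => by
        rw [LieHom.map_lie]
        simp only [LieRing.of_associative_ring_bracket, add_mul, mul_add,
          Algebra.TensorProduct.tmul_mul_tmul, one_mul, mul_one, TensorProduct.sub_tmul,
          TensorProduct.tmul_sub]
        abel }
    (fun x => by
      have hp : p.Prime := Fact.out
      have hz : (p : RestrictedEnveloping k p L ⊗[k] RestrictedEnveloping k p L) = 0 := by
        rw [← map_natCast (algebraMap k _), CharP.cast_eq_zero, map_zero]
      have hc : Commute (ι k p x ⊗ₜ[k] (1 : RestrictedEnveloping k p L))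
          ((1 : RestrictedEnveloping k p L) ⊗ₜ[k] ι k p x) := by
        simp [commute_iff_eq, Algebra.TensorProduct.tmul_mul_tmul]
      obtain ⟨r, hr⟩ := hc.exists_add_pow_prime_eq hp
      change ι k p (pPow k p x) ⊗ₜ[k] 1 + 1 ⊗ₜ[k] ι k p (pPow k p x) =
        (ι k p x ⊗ₜ[k] 1 + 1 ⊗ₜ[k] ι k p x) ^ p
      rw [hr, hz, ι_pPow]
      simp [Algebra.TensorProduct.tmul_pow])

@[simp]
lemma comulHom_ι (x : L) : comulHom k p L (ι k p x) = ι k p x ⊗ₜ[k] 1 + 1 ⊗ₜ[k] ι k p x :=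
  lift_ι _ _ x

/-- The bialgebra structure of the restricted universal enveloping algebra, in which the elements
of `L` are primitive. -/
instance instBialgebra : Bialgebra k (RestrictedEnveloping k p L) :=
  .ofAlgHom (comulHom k p L) (counitHom k p L)
    (algHom_ext fun x => by
      simp [Algebra.TensorProduct.one_def, TensorProduct.add_tmul, TensorProduct.tmul_add]
      abel)
    (algHom_ext fun x => by simp)
    (algHom_ext fun x => by simp)

lemma counit_ι (x : L) : Coalgebra.counit (R := k) (ι k p x) = 0 :=
  counitHom_ι k p L x

variable {L}

lemma ι_mem_primitives (x : L) : ι k p x ∈ primitives k (RestrictedEnveloping k p L) :=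
  comulHom_ι k p L x

variable (L)

/-- The canonical morphism of restricted Lie algebras from `L` to the primitive elements of its
restricted universal enveloping algebra. -/
def unitHom : RestrictedLieHom k p L (primitives k (RestrictedEnveloping k p L)) where
  toLieHom :=
    { toFun := fun x => ⟨ι k p x, ι_mem_primitives k p x⟩
      map_add' := fun x y => Subtype.ext (map_add _ x y)
      map_smul' := fun a x => Subtype.ext (map_smul _ a x)
      map_lie' := fun {x y} => Subtype.ext (LieHom.map_lie _ x y) }
  map_pPow x := Subtype.ext (ι_pPow k p x)

variable {k p L} {B : Type*} [Ring B] [Bialgebra k B]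

/-- A morphism of restricted Lie algebras `L → 𝒫 B`, viewed as a map to `B`. -/
def toBialgebra (f : RestrictedLieHom k p L (primitives k B)) : L →ₗ⁅k⁆ B :=
  (primitives k B).incl.comp f.toLieHom

lemma toBialgebra_pPow (f : RestrictedLieHom k p L (primitives k B)) (x : L) :
    toBialgebra f (pPow k p x) = toBialgebra f x ^ p :=
  congrArg Subtype.val (f.map_pPow x)

/-- The bialgebra morphism `ũ L → B` extending a morphism of restricted Lie algebras
`L → 𝒫 B`. -/
def bialgLift (f : RestrictedLieHom k p L (primitives k B)) : RestrictedEnveloping k p L →ₐc[k] B :=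
  .ofAlgHom
    (lift (toBialgebra f) (toBialgebra_pPow f))
    (algHom_ext fun x => by
      have h := counit_eq_zero_of_mem_primitives (f.toLieHom x).2
      rw [AlgHom.comp_apply, lift_ι]
      exact h.trans (counit_ι k p L x).symm)
    (algHom_ext fun x => by
      have h := mem_primitives.1 (f.toLieHom x).2
      have h' := mem_primitives.1 (ι_mem_primitives k p x)
      rw [AlgHom.comp_apply, AlgHom.comp_apply, lift_ι, Bialgebra.comulAlgHom_apply,
        Bialgebra.comulAlgHom_apply, h', map_add, Algebra.TensorProduct.map_tmul,
        Algebra.TensorProduct.map_tmul, map_one, lift_ι]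
      exact h.symm)

@[simp]
lemma bialgLift_ι (f : RestrictedLieHom k p L (primitives k B)) (x : L) :
    bialgLift f (ι k p x) = f.toLieHom x :=
  lift_ι _ _ x

lemma bialgHom_ext {f g : RestrictedEnveloping k p L →ₐc[k] B}
    (h : ∀ x, f (ι k p x) = g (ι k p x)) : f = g := by
  have h' : (f : RestrictedEnveloping k p L →ₐ[k] B) = (g : RestrictedEnveloping k p L →ₐ[k] B) :=
    algHom_ext h
  exact BialgHom.ext fun x => DFunLike.congr_fun h' x

lemma bialgLift_comp {M : Type*} [LieRing M] [LieAlgebra k M] [RestrictedLieAlgebra k p M]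
    (g : RestrictedLieHom k p M (primitives k B)) (f : RestrictedLieHom k p L M) :
    (bialgLift g).comp (bialgLift ((unitHom k p M).comp f)) = bialgLift (g.comp f) :=
  bialgHom_ext fun x => by
    rw [BialgHom.comp_apply, bialgLift_ι, bialgLift_ι]
    exact bialgLift_ι g (f.toLieHom x)

lemma comp_bialgLift {B' : Type*} [Ring B'] [Bialgebra k B'] (g : B →ₐc[k] B')
    (f : RestrictedLieHom k p L (primitives k B)) :
    g.comp (bialgLift f) = bialgLift ((restrictedPrimitivesMap p g).comp f) :=
  bialgHom_ext fun x => by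
    rw [BialgHom.comp_apply, bialgLift_ι, bialgLift_ι]
    rfl

variable (k p L) in
lemma bialgLift_unitHom :
    bialgLift (unitHom k p L) = BialgHom.id k (RestrictedEnveloping k p L) :=
  bialgHom_ext fun x => bialgLift_ι _ x

end RestrictedEnveloping

open RestrictedEnveloping

lemma bialgLift_id_natural {k : Type*} {p : ℕ} [Field k] [Fact p.Prime] [CharP k p] {B B' : Type*}
    [Ring B] [Bialgebra k B] [Ring B'] [Bialgebra k B'] (g : B →ₐc[k] B') :
    (bialgLift (RestrictedLieHom.id k p (primitives k B'))).comp
        (bialgLift ((unitHom k p (primitives k B')).comp (restrictedPrimitivesMap p g))) =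
      g.comp (bialgLift (RestrictedLieHom.id k p (primitives k B))) := by
  rw [bialgLift_comp, comp_bialgLift]
  rfl

lemma bialgLift_id_triangle (k : Type*) (p : ℕ) [Field k] [Fact p.Prime] [CharP k p] (L : Type*)
    [LieRing L] [LieAlgebra k L] [RestrictedLieAlgebra k p L] :
    (bialgLift (RestrictedLieHom.id k p (primitives k (RestrictedEnveloping k p L)))).comp
        (bialgLift ((unitHom k p (primitives k (RestrictedEnveloping k p L))).comp
          (unitHom k p L))) =
      BialgHom.id k (RestrictedEnveloping k p L) := by
  rw [bialgLift_comp]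
  exact bialgLift_unitHom k p L

lemma zeta_natural {k : Type*} {p : ℕ} [Field k] [Fact p.Prime] [CharP k p] {L M : Type*}
    [LieRing L] [LieAlgebra k L] [RestrictedLieAlgebra k p L]
    [LieRing M] [LieAlgebra k M] [RestrictedLieAlgebra k p M] (f : RestrictedLieHom k p L M) :
    (tensorLift ((unitHom k p M).toLieHom : M →ₗ[k] _)).comp
        (tensorLift (tensorUnit k M ∘ₗ (f.toLieHom : L →ₗ[k] M))) =
      (bialgLift ((unitHom k p M).comp f)).comp
        (tensorLift ((unitHom k p L).toLieHom : L →ₗ[k] _)) := by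
  rw [tensorLift_comp, comp_tensorLift]
  exact congrArg tensorLift (LinearMap.ext fun x => Subtype.ext
    (bialgLift_ι ((unitHom k p M).comp f) x).symm)

/-- The functor `ũ : Lie_p ⥤ Bialg`. -/
def envelopingFunctor (k : Type u) [Field k] (p : ℕ) [Fact p.Prime] [CharP k p] :
    LieP.{u, v} k p ⥤ BialgCat.{max u v} k where
  obj L := BialgCat.of k (RestrictedEnveloping k p L)
  map {L M} f := BialgCat.ofHom
    (bialgLift (RestrictedLieHom.comp (L := L) (unitHom k p M) f))
  map_id L := BialgCat.hom_ext _ _ (bialgLift_unitHom k p L)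
  map_comp {L M N} f g := BialgCat.hom_ext _ _
    (bialgLift_comp (L := L) (M := M) (RestrictedLieHom.comp (unitHom k p N) g) f).symm

attribute [local irreducible] bialgLift RestrictedEnveloping.instRing
  RestrictedEnveloping.instAlgebra comulHom counitHom RestrictedEnveloping RestrictedEnveloping.ι

/-- The adjunction `ũ ⊣ 𝒫`, with unit `L → 𝒫(ũ L)` the canonical map. -/
def envelopingAdjunction (k : Type u) [Field k] (p : ℕ) [Fact p.Prime] [CharP k p] :
    envelopingFunctor.{u, max u v} k p ⊣ primitiveFunctor.{u, max u v} k p where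
  unit :=
    { app := fun L => unitHom k p L
      naturality := fun _ M f => RestrictedLieHom.ext (LieHom.ext fun x => Subtype.ext
        (bialgLift_ι (RestrictedLieHom.comp (unitHom k p M) f) x).symm) }
  counit :=
    { app := fun B => BialgCat.ofHom (bialgLift (RestrictedLieHom.id k p (primitives k B)))
      naturality := fun _ _ f => BialgCat.hom_ext _ _
        (bialgLift_id_natural f.toBialgHom) }
  left_triangle_components L := by
    have h := congrArg
      (BialgCat.ofHom (X := RestrictedEnveloping k p L) (Y := RestrictedEnveloping k p L))
      (bialgLift_id_triangle k p L)
    change BialgCat.ofHom (BialgHom.comp _ _) = BialgCat.ofHom (BialgHom.id k _)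
    exact h
  right_triangle_components _ := RestrictedLieHom.ext (LieHom.ext fun x => Subtype.ext
    (bialgLift_ι _ x))

/-- The natural transformation `ζ₁₁ : T̃ H ⟶ ũ`: its component at `L` is the bialgebra morphism
`T̃ L → ũ L` which is the identity on `L`. -/
def zetaOneOne (k : Type u) [Field k] (p : ℕ) [Fact p.Prime] [CharP k p] :
    forgetLieP.{u, v} k p ⋙ tensorFunctor.{u, v} k ⟶ envelopingFunctor.{u, v} k p where
  app L := BialgCat.ofHom (tensorLift ((unitHom k p L).toLieHom : L →ₗ[k] _))
  naturality L M f := by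
    have h := congrArg
      (BialgCat.ofHom (X := TensorAlgebra k L) (Y := RestrictedEnveloping k p M))
      (zeta_natural (L := L) (M := M) f)
    change BialgCat.ofHom (BialgHom.comp _ _) = BialgCat.ofHom (BialgHom.comp _ _)
    exact h

end Enveloping

end RestrictedLie

end

open RestrictedLie

/-! The crux is that the canonical map from `L` to the primitive elements of its restricted
enveloping algebra is bijective (`unitHom_bijective`); the adjunction then follows formally.

Bijectivity rests on the restricted Poincaré–Birkhoff–Witt theorem. Order a basis `x_i` of `L`. In
the tensor algebra, rewrite `x_j x_i` to `x_i x_j + [x_j, x_i]` for `i < j`, and `x_i ^ p` to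
`x_i^{[p]}`. The irreducible words are the nondecreasing ones with every exponent below `p`.
Rewriting terminates, so they span (`span_normalWord`). They are independent by the diamond lemma
(`exists_normalForm`): the overlap `x_l x_j x_i` resolves by the Jacobi identity, `x_j ^ p x_i` and
`x_j x_i ^ p` by `ad (x^{[p]}) = (ad x) ^ p`, and `x_i ^ (p + r)` by `[x^{[p]}, x] = 0`
(`RespectsBelow.resolve`). Rules for basis vectors suffice, since Jacobson's formula carries the
`p`-map relation from a basis to all of `L`.

Letters are primitive, so contracting the comultiplication with the coordinate of `x_i` acts on
normal words as the partial derivative along `x_i`. A primitive element is sent to a scalar by this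
contraction. Exponents below `p` are invertible when nonzero, so a primitive element has no
coefficient at words of length at least two; the counit kills its constant term. What remains lies
in `L`.

For the adjunction, the triangle at `L` holds because `ζ₁₁` is the canonical map on generators. For
the triangle at `V`, let `θ : T̃ V → ũ (𝒫 (T̃ V))` extend `v ↦ v`, and let `ε` be the counit back to
`T̃ V`, so that `ε θ = id`. If `x` is primitive then so is `θ x`, hence `θ x` is the image of some
`y` in `𝒫 (T̃ V)`; applying `ε` gives `y = x` (`zeta_comp_unit`). -/

namespace RestrictedLie

/-! ### The diamond lemma in linear form. -/

section Diamond

/-- A linear form of Bergman's diamond lemma. `R D t` says that the basis vector `B D` may be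
rewritten to `t`, a combination of smaller basis vectors; if all ambiguities are resolvable, then
every function on the irreducible basis vectors extends to a linear map respecting the rules. -/
theorem exists_linearMap_of_resolvable {W k T M : Type*} [Field k] [AddCommGroup T] [Module k T]
    [AddCommGroup M] [Module k M] (B : Module.Basis W k T) (r : W → W → Prop) (hr : WellFounded r)
    (R : W → T → Prop) (hsmall : ∀ D t, R D t → t ∈ Submodule.span k (B '' {D' | r D' D}))
    (hres : ∀ D t₁ t₂, R D t₁ → R D t₂ → ∀ N : T →ₗ[k] M,
      (∀ D' t', r D' D → R D' t' → N (B D') = N t') → N t₁ = N t₂)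
    (base : W → M) :
    ∃ N : T →ₗ[k] M, (∀ D t, R D t → N (B D) = N t) ∧
      ∀ D, (∀ t, ¬ R D t) → N (B D) = base D := by
  classical
  let F : ∀ D, (∀ D', r D' D → M) → M := fun D rec =>
    if h : ∃ t, R D t then
      -- Zero is a dummy value off the vectors below `D`: by `hsmall` the chosen right-hand side
      -- does not involve them.
      B.constr k (fun D' => if h' : r D' D then rec D' h' else 0) h.choose
    else base D
  let N₀ : W → M := hr.fix F
  have hN₀ : ∀ D, N₀ D = F D fun D' _ => N₀ D' := fun D => hr.fix_eq F D
  let N : T →ₗ[k] M := B.constr k N₀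
  have hN : ∀ D, N (B D) = N₀ D := fun D => B.constr_basis k N₀ D
  have hchoose : ∀ D (h : ∃ t, R D t), N (B D) = N h.choose := by
    intro D h
    rw [hN, hN₀]
    simp only [F, dif_pos h]
    have key : Submodule.span k (B '' {D' | r D' D}) ≤ LinearMap.eqLocus
        (B.constr k (fun D' => if r D' D then N₀ D' else 0)) N := by
      rw [Submodule.span_le]
      rintro _ ⟨D', hD', rfl⟩
      have hD'' : r D' D := hD'
      simp [LinearMap.mem_eqLocus, hN, hD'']
    exact key (hsmall D _ h.choose_spec)
  refine ⟨N, fun D => ?_, fun D hD => ?_⟩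
  · induction D using hr.induction with
    | _ D ih =>
      intro t ht
      have h : ∃ t, R D t := ⟨t, ht⟩
      rw [hchoose D h]
      -- Resolvability makes the choice of rule in the recursion immaterial.
      exact hres D _ _ h.choose_spec ht N fun D' t' hD' ht' => ih D' hD' t' ht'
  · rw [hN, hN₀]
    exact dif_neg (not_exists.2 hD)

end Diamond

/-! ### A well-founded order on words, compatible with concatenation. -/

section Words

variable {I : Type*} [LinearOrder I]

/-- The number of inversions of a word. -/
def inversions : List I → ℕ
  | [] => 0
  | a :: l => l.countP (· < a) + inversions l

lemma inversions_swap_lt (A C : List I) {i j : I} (h : i < j) :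
    inversions (A ++ i :: j :: C) < inversions (A ++ j :: i :: C) := by
  induction A with
  | nil => simp [inversions, h, not_lt.2 h.le]; omega
  | cons a A ih =>
    simp only [List.cons_append, inversions, List.countP_append, List.countP_cons]
    omega

/-- The cross term depends only on the letters of `A` and `C`, not on their order. This is why
`WordLT` compares inversions only between permutations: it is then stable under concatenation. -/
lemma inversions_append (A C : List I) : inversions (A ++ C) =
    inversions A + inversions C + (A.map fun a => C.countP (· < a)).sum := by
  induction A with
  | nil => simp [inversions]
  | cons a A ih =>
    simp only [List.cons_append, inversions, List.countP_append, List.map_cons, List.sum_cons, ih]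
    omega

/-- Words are ordered by length, and words that are permutations of each other by the number of
inversions. -/
def WordLT (D D' : List I) : Prop :=
  D.length < D'.length ∨ D.Perm D' ∧ inversions D < inversions D'

lemma wordLT_wellFounded : WellFounded (WordLT : List I → List I → Prop) := by
  refine Subrelation.wf (r := InvImage (Prod.Lex (· < ·) (· < ·))
    fun D : List I => (D.length, inversions D)) ?_
    (InvImage.wf _ (WellFounded.prod_lex wellFounded_lt wellFounded_lt))
  rintro D D' (h | ⟨h, h'⟩)
  · exact Prod.lex_def.2 (Or.inl h)
  · exact Prod.lex_def.2 (Or.inr ⟨h.length_eq, h'⟩)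

lemma WordLT.of_length {D D' : List I} (h : D.length < D'.length) : WordLT D D' := Or.inl h

lemma WordLT.trans {D D' D'' : List I} (h : WordLT D D') (h' : WordLT D' D'') : WordLT D D'' := by
  rcases h with h | ⟨h, h1⟩ <;> rcases h' with h' | ⟨h', h2⟩
  · exact Or.inl (h.trans h')
  · exact Or.inl (h'.length_eq ▸ h)
  · exact Or.inl (h.length_eq ▸ h')
  · exact Or.inr ⟨h.trans h', h1.trans h2⟩

lemma WordLT.append_right {D D' : List I} (h : WordLT D D') (E : List I) :
    WordLT (D ++ E) (D' ++ E) := by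
  rcases h with h | ⟨h, h1⟩
  · exact Or.inl (by simpa using h)
  · refine Or.inr ⟨h.append_right E, ?_⟩
    rw [inversions_append, inversions_append,
      (h.map fun a => E.countP fun x => decide (x < a)).sum_eq]
    omega

lemma WordLT.append_left {D D' : List I} (h : WordLT D D') (E : List I) :
    WordLT (E ++ D) (E ++ D') := by
  rcases h with h | ⟨h, h1⟩
  · exact Or.inl (by simpa using h)
  · refine Or.inr ⟨h.append_left E, ?_⟩
    simp only [inversions_append, h.countP_eq]
    omega

lemma wordLT_swap (A C : List I) {i j : I} (h : i < j) :
    WordLT (A ++ i :: j :: C) (A ++ j :: i :: C) :=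
  Or.inr ⟨(List.Perm.swap j i C).append_left A, inversions_swap_lt A C h⟩

end Words

/-! ### The word basis of the tensor algebra and the rewriting rules. -/

section Rules

variable {I k L : Type*} [Field k] [LieRing L] [LieAlgebra k L] (b : Module.Basis I k L)

/-- The word in the tensor algebra spelled by a list of basis vectors. -/
noncomputable def word (D : List I) : TensorAlgebra k L :=
  (D.map fun i => TensorAlgebra.ι k (b i)).prod

@[simp] lemma word_nil : word b [] = 1 := rfl

@[simp] lemma word_cons (i : I) (D : List I) :
    word b (i :: D) = TensorAlgebra.ι k (b i) * word b D := by simp [word]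

@[simp] lemma word_append (D D' : List I) : word b (D ++ D') = word b D * word b D' := by
  simp [word]

@[simp] lemma word_replicate (n : ℕ) (i : I) :
    word b (List.replicate n i) = TensorAlgebra.ι k (b i) ^ n := by simp [word]

/-- The basis of the tensor algebra consisting of the words in the basis vectors. -/
noncomputable def wordBasis : Module.Basis (List I) k (TensorAlgebra k L) :=
  b.tensorAlgebra.reindex FreeMonoid.toList

@[simp] lemma wordBasis_apply (D : List I) : wordBasis b D = word b D := by
  rw [wordBasis, Module.Basis.reindex_apply, Module.Basis.tensorAlgebra, Module.Basis.map_apply]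
  change (TensorAlgebra.equivFreeAlgebra b).symm _ = _
  have h : FreeAlgebra.basisFreeMonoid k I (FreeMonoid.ofList D) =
      (D.map (FreeAlgebra.ι k)).prod := by
    change (FreeAlgebra.equivMonoidAlgebraFreeMonoid (R := k) (X := I)).symm
      (MonoidAlgebra.single (FreeMonoid.ofList D) 1) = _
    refine (MonoidAlgebra.lift_single ..).trans ?_
    rw [one_smul, FreeMonoid.lift_ofList]
  change (TensorAlgebra.equivFreeAlgebra b).symm
    (FreeAlgebra.basisFreeMonoid k I (FreeMonoid.ofList D)) = _
  rw [h, map_list_prod, List.map_map, word]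
  congr 1
  refine List.map_congr_left fun i _ => ?_
  simp

/-- The rewriting rules on words that present the restricted universal enveloping algebra. -/
inductive WordRule [LinearOrder I] (p : ℕ) [RestrictedLieAlgebra k p L] :
    List I → TensorAlgebra k L → Prop
  | swap (A C : List I) {i j : I} (h : i < j) : WordRule p (A ++ j :: i :: C)
      (word b A * (TensorAlgebra.ι k (b i) * TensorAlgebra.ι k (b j) +
        TensorAlgebra.ι k ⁅b j, b i⁆) * word b C)
  | pow (A C : List I) (i : I) : WordRule p (A ++ (List.replicate p i ++ C))
      (word b A * TensorAlgebra.ι k (pPow k p (b i)) * word b C)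

lemma mem_of_forall_basis {M : Type*} [AddCommGroup M] [Module k M] {S : Submodule k M}
    (f : L →ₗ[k] M) (h : ∀ i, f (b i) ∈ S) (x : L) : f x ∈ S := by
  have : Submodule.span k (Set.range b) ≤ S.comap f := by
    rw [Submodule.span_le]
    rintro _ ⟨i, rfl⟩
    exact h i
  rw [b.span_eq] at this
  exact this trivial

variable [LinearOrder I] {p : ℕ} [RestrictedLieAlgebra k p L]

/-- Expanding `x` in the basis gives words of length `|A| + |C| + 1`. This handles the bracket and
`p`-map terms, which are shorter than the word being rewritten. -/
lemma mul_ι_mul_mem (A C D : List I) (h : A.length + C.length + 1 < D.length) (x : L) :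
    word b A * TensorAlgebra.ι k x * word b C ∈
      Submodule.span k (wordBasis b '' {D' | WordLT D' D}) := by
  refine mem_of_forall_basis b (LinearMap.mulRight k (word b C) ∘ₗ
    LinearMap.mulLeft k (word b A) ∘ₗ TensorAlgebra.ι k) (fun i => ?_) x
  refine Submodule.subset_span ⟨A ++ i :: C, WordLT.of_length (by simp; omega), ?_⟩
  simp [mul_assoc]

/-- Termination: a swap removes an inversion, and all other terms are shorter, for the power rule
because `2 ≤ p`. -/
lemma WordRule.mem_span (hp : p.Prime) {D : List I} {t : TensorAlgebra k L}
    (h : WordRule b p D t) : t ∈ Submodule.span k (wordBasis b '' {D' | WordLT D' D}) := by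
  cases h with
  | swap A C h =>
    rw [mul_add, add_mul]
    refine add_mem (Submodule.subset_span ⟨_, wordLT_swap A C h, ?_⟩)
      (mul_ι_mul_mem b A C _ (by simp; omega) _)
    simp [mul_assoc]
  | pow A C i =>
    have := hp.two_le
    exact mul_ι_mul_mem b A C _ (by simp; omega) _

end Rules

/-! ### Resolution of the overlap ambiguities. -/

section Resolvable

variable {I k L M : Type*} [LinearOrder I] [Field k] [LieRing L] [LieAlgebra k L]
  [AddCommGroup M] [Module k M] (b : Module.Basis I k L) (p : ℕ) [RestrictedLieAlgebra k p L]

/-- The linear map `N` is compatible with the rewriting rules for the words below `D`. -/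
def RespectsBelow (N : TensorAlgebra k L →ₗ[k] M) (D : List I) : Prop :=
  ∀ D' t', WordLT D' D → WordRule b p D' t' → N (word b D') = N t'

variable {b p} {N : TensorAlgebra k L →ₗ[k] M} {D : List I}

local notation "τ" => TensorAlgebra.ι k (M := L)

lemma RespectsBelow.swap_word (hN : RespectsBelow b p N D) (A C : List I) {i j : I} (h : i < j)
    (hD : WordLT (A ++ j :: i :: C) D) :
    N (word b (A ++ j :: i :: C)) =
      N (word b (A ++ i :: j :: C)) + N (word b A * τ ⁅b j, b i⁆ * word b C) := by
  rw [hN _ _ hD (.swap A C h), mul_add, add_mul, map_add]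
  simp [mul_assoc]

lemma RespectsBelow.pow_word (hN : RespectsBelow b p N D) (A C : List I) (i : I)
    (hD : WordLT (A ++ (List.replicate p i ++ C)) D) :
    N (word b A * τ (b i) ^ p * word b C) = N (word b A * τ (pPow k p (b i)) * word b C) := by
  rw [← hN _ _ hD (.pow A C i)]
  simp [mul_assoc]

/-- The rule for `i < j` gives all pairs by skew symmetry. The bound on lengths, unlike `WordLT`,
ignores which letters occur, so it survives bilinear extension. -/
lemma RespectsBelow.swap_basis (hN : RespectsBelow b p N D) (A C : List I)
    (h : A.length + C.length + 2 < D.length) (i j : I) :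
    N (word b A * (τ (b j) * τ (b i)) * word b C) =
      N (word b A * (τ (b i) * τ (b j)) * word b C) +
        N (word b A * τ ⁅b j, b i⁆ * word b C) := by
  have key : ∀ {i j : I}, i < j → N (word b A * (τ (b j) * τ (b i)) * word b C) =
      N (word b A * (τ (b i) * τ (b j)) * word b C) +
        N (word b A * τ ⁅b j, b i⁆ * word b C) := by
    intro i j hij
    have := hN.swap_word A C hij (.of_length (by simp; omega))
    simpa [mul_assoc] using this
  rcases lt_trichotomy i j with hij | rfl | hij
  · exact key hij
  · simp
  · rw [key hij, ← lie_skew (b j)]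
    simp only [map_neg, mul_neg, neg_mul]
    abel

lemma RespectsBelow.swap (hN : RespectsBelow b p N D) (A C : List I)
    (h : A.length + C.length + 2 < D.length) (x y : L) :
    N (word b A * (τ x * τ y) * word b C) =
      N (word b A * (τ y * τ x) * word b C) + N (word b A * τ ⁅x, y⁆ * word b C) := by
  let G : TensorAlgebra k L →ₗ[k] M :=
    N ∘ₗ LinearMap.mulRight k (word b C) ∘ₗ LinearMap.mulLeft k (word b A)
  -- The defect of the identity, linear in `x` for fixed `y`. Being skew, it is linear in either
  -- argument, so it vanishes once it vanishes on pairs of basis vectors.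
  let f : L → L →ₗ[k] M := fun y => G ∘ₗ
    ((LinearMap.mulRight k (τ y) - LinearMap.mulLeft k (τ y)) ∘ₗ τ + τ ∘ₗ LieAlgebra.ad k L y)
  have hf : ∀ x y, f y x = N (word b A * (τ x * τ y) * word b C) -
      N (word b A * (τ y * τ x) * word b C) - N (word b A * τ ⁅x, y⁆ * word b C) := by
    intro x y
    simp only [f, G, LinearMap.comp_apply, LinearMap.add_apply, LinearMap.sub_apply,
      LinearMap.mulRight_apply, LinearMap.mulLeft_apply, LieAlgebra.ad_apply, ← lie_skew x y]
    simp only [map_neg, mul_add, mul_sub, add_mul, sub_mul, map_add, map_sub, mul_neg, neg_mul]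
    abel
  have hskew : ∀ x y, f y x = - f x y := by
    intro x y
    rw [hf, hf, ← lie_skew x y]
    simp only [map_neg, mul_neg, neg_mul]
    abel
  have h1 : ∀ i y, f y (b i) = 0 := by
    intro i y
    rw [hskew, neg_eq_zero]
    refine (Submodule.mem_bot k).1 (mem_of_forall_basis b _ (fun j => ?_) y)
    rw [Submodule.mem_bot, hf, hN.swap_basis A C h]
    abel
  have h2 : f y x = 0 :=
    (Submodule.mem_bot k).1 (mem_of_forall_basis b _ (fun i => (Submodule.mem_bot k).2 (h1 i y)) x)
  rw [hf, sub_sub, sub_eq_zero] at h2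
  exact h2

lemma RespectsBelow.commute_pow (hN : RespectsBelow b p N D) (A C : List I) (i : I) (y : L)
    (hy : ⁅y, b i⁆ = 0) (r : ℕ) (h : A.length + C.length + r + 1 < D.length) :
    N (word b A * (τ y * τ (b i) ^ r) * word b C) =
      N (word b A * (τ (b i) ^ r * τ y) * word b C) := by
  induction r generalizing A with
  | zero => simp
  | succ r ih =>
    have h1 := hN.swap A (List.replicate r i ++ C) (by simp; omega) y (b i)
    have h2 := ih (A ++ [i]) (by simp; omega)
    rw [hy, map_zero, mul_zero, zero_mul, map_zero, add_zero] at h1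
    simp only [word_append, word_replicate, word_cons, word_nil, mul_one, mul_assoc] at h1 h2
    simp only [pow_succ', mul_assoc]
    rw [h1, h2]

/-- Below `D` the map `N` does not distinguish commutators from Lie brackets. In the induction the
outer factor `x_i` is absorbed into `A` or into `C`, hence the generalization over both. -/
lemma RespectsBelow.ad_pow (hN : RespectsBelow b p N D) (A C : List I) (i : I) (n : ℕ) (z : L)
    (h : A.length + C.length + n + 1 < D.length) :
    N (word b A * ((LinearMap.mulLeft ℤ (τ (b i)) - LinearMap.mulRight ℤ (τ (b i))) ^ n) (τ z) *
        word b C) =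
      N (word b A * τ ((LieAlgebra.ad k L (b i) ^ n) z) * word b C) := by
  induction n generalizing A C with
  | zero => simp
  | succ n ih =>
    rw [pow_succ', pow_succ', Module.End.mul_apply, Module.End.mul_apply]
    set u := ((LinearMap.mulLeft ℤ (τ (b i)) - LinearMap.mulRight ℤ (τ (b i))) ^ n) (τ z)
    have h1 := ih (A ++ [i]) C (by simp; omega)
    have h2 := ih A (i :: C) (by simp; omega)
    have h3 := hN.swap A C (by omega) (b i) ((LieAlgebra.ad k L (b i) ^ n) z)
    simp only [word_append, word_cons, word_nil, mul_one, mul_assoc] at h1 h2 h3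
    simp only [LinearMap.sub_apply, LinearMap.mulLeft_apply, LinearMap.mulRight_apply, mul_sub,
      sub_mul, map_sub, mul_assoc, LieAlgebra.ad_apply]
    rw [h1, h2, h3]
    abel

variable (k) in
-- The signs of the binomial coefficients `(p - 1).choose c` modulo `p` cancel those of the
-- expansion. The left side is what accumulates when a letter is moved past a `p`-th power.
lemma sum_pow_mul_pow (hp : p.Prime) [CharP k p] {A : Type*} [Ring A] [Algebra k A] (x y : A) :
    ∑ c ∈ Finset.range p, x ^ c * y * x ^ (p - 1 - c) =
      ((LinearMap.mulLeft ℤ x - LinearMap.mulRight ℤ x) ^ (p - 1)) y := by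
  have hA : (p : A) = 0 := by
    rw [← map_natCast (algebraMap k A), CharP.cast_eq_zero, map_zero]
  rw [sub_pow_pred p hp (cast_end_eq_zero p hA) _ _ (LinearMap.commute_mulLeft_right (R := ℤ) x x)]
  simp [LinearMap.pow_mulLeft, LinearMap.pow_mulRight, mul_assoc]

variable (p) in
-- One factor of `(ad x) ^ p` is spent on the bracket `⁅x, y⁆`, which is the term produced by a
-- swap.
lemma lie_pPow_eq (hp : p.Prime) (x y : L) :
    ⁅pPow k p x, y⁆ = (LieAlgebra.ad k L x ^ (p - 1)) ⁅x, y⁆ := by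
  have h := DFunLike.congr_fun (RestrictedLieAlgebra.ad_pMap (k := k) (p := p) x) y
  refine h.trans ?_
  rw [← LieAlgebra.ad_apply k, ← Module.End.mul_apply, ← pow_succ, Nat.sub_add_cancel hp.one_le]

/-- The overlap `x_l x_j x_i`. -/
lemma RespectsBelow.resolve_swap_swap (A C : List I) {i j l : I} (hij : i < j) (hjl : j < l)
    (hN : RespectsBelow b p N (A ++ l :: j :: i :: C)) :
    N (word b A * (τ (b j) * τ (b l) + τ ⁅b l, b j⁆) * word b (i :: C)) =
      N (word b (A ++ [l]) * (τ (b i) * τ (b j) + τ ⁅b j, b i⁆) * word b C) := by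
  -- The two routes from `x_l x_j x_i` down to `x_i x_j x_l`; every intermediate word must lie below
  -- the start for `N` to respect its rules.
  have a1 : WordLT (A ++ j :: l :: i :: C) (A ++ l :: j :: i :: C) := wordLT_swap _ _ hjl
  have a2 : WordLT (A ++ j :: i :: l :: C) (A ++ l :: j :: i :: C) := by
    refine .trans ?_ a1
    simpa using wordLT_swap (A ++ [j]) C (hij.trans hjl)
  have b1 : WordLT (A ++ l :: i :: j :: C) (A ++ l :: j :: i :: C) := by
    simpa using wordLT_swap (A ++ [l]) C hij
  have b2 : WordLT (A ++ i :: l :: j :: C) (A ++ l :: j :: i :: C) :=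
    .trans (wordLT_swap _ _ (hij.trans hjl)) b1
  have e1 := hN.swap_word (A ++ [j]) C (hij.trans hjl) (by simpa using a1)
  have e2 := hN.swap_word A (l :: C) hij a2
  have e3 := hN.swap_word A (j :: C) (hij.trans hjl) b1
  have e4 := hN.swap_word (A ++ [i]) C hjl (by simpa using b2)
  have f1 := hN.swap A C (by simp; omega) ⁅b l, b j⁆ (b i)
  have f2 := hN.swap A C (by simp; omega) (b l) ⁅b j, b i⁆
  have f3 := hN.swap A C (by simp; omega) (b j) ⁅b l, b i⁆
  -- The double brackets left over by the two routes agree by the Jacobi identity.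
  have jac : N (word b A * τ ⁅b l, ⁅b j, b i⁆⁆ * word b C) =
      N (word b A * τ ⁅⁅b l, b j⁆, b i⁆ * word b C) +
        N (word b A * τ ⁅b j, ⁅b l, b i⁆⁆ * word b C) := by
    rw [leibniz_lie (b l), map_add, mul_add, add_mul, map_add]
  simp only [word_append, word_cons, word_nil, mul_one, mul_assoc, mul_add, add_mul, map_add]
    at e1 e2 e3 e4 f1 f2 f3 jac ⊢
  rw [e1, e2, e3, e4, f1, f2, f3, jac]
  abel

/-- Each copy of `j` that `i` passes removes an inversion. The count is `c + 1` because the order is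
strict: at least one copy must be passed. -/
lemma wordLT_pow_swap (A C : List I) {i j : I} (hij : i < j) (a c : ℕ) :
    WordLT (A ++ (List.replicate a j ++ i :: (List.replicate (c + 1) j ++ C)))
      (A ++ (List.replicate (a + (c + 1)) j ++ i :: C)) := by
  have h : ∀ n (C : List I), WordLT (A ++ (List.replicate n j ++ i :: j :: C))
      (A ++ (List.replicate (n + 1) j ++ i :: C)) := by
    intro n C
    simpa [List.replicate_succ'] using wordLT_swap (A ++ List.replicate n j) C hij
  induction c generalizing C with
  | zero => exact h a C
  | succ c ih =>
    refine WordLT.trans ?_ (h (a + (c + 1)) C)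
    simpa [List.replicate_succ' (n := c + 1)] using ih (j :: C)

lemma wordLT_swap_pow (A C : List I) {i j : I} (hij : i < j) (a c : ℕ) :
    WordLT (A ++ (List.replicate (c + 1) i ++ j :: (List.replicate a i ++ C)))
      (A ++ j :: (List.replicate (c + 1 + a) i ++ C)) := by
  have h : ∀ n (A : List I), WordLT (A ++ i :: j :: (List.replicate n i ++ C))
      (A ++ j :: (List.replicate (n + 1) i ++ C)) := by
    intro n A
    simpa [List.replicate_succ] using wordLT_swap A (List.replicate n i ++ C) hij
  induction c generalizing A with
  | zero => simpa [add_comm] using h a A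
  | succ c ih =>
    have e : c + 1 + 1 + a = c + 1 + a + 1 := by omega
    rw [e]
    refine WordLT.trans ?_ (h (c + 1 + a) A)
    simpa [List.replicate_succ (n := c + 1)] using ih (A ++ [i])

/-- The overlap `x_j ^ p x_i`. -/
lemma RespectsBelow.resolve_pow_swap (hp : p.Prime) [CharP k p] (A C : List I) {i j : I}
    (hij : i < j) (hN : RespectsBelow b p N (A ++ (List.replicate p j ++ i :: C))) :
    N (word b A * τ (pPow k p (b j)) * word b (i :: C)) =
      N (word b (A ++ List.replicate (p - 1) j) * (τ (b i) * τ (b j) + τ ⁅b j, b i⁆) *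
        word b C) := by
  have hp2 := hp.two_le
  have hq : p - 1 + 1 = p := by omega
  -- Move `x_i` left past `a` copies of `x_j`, leaving one bracket per copy. The exponent `c + 1`
  -- excludes the full word, on which `N` is not yet known to respect the rules.
  have key : ∀ a c, a + (c + 1) = p →
      N (word b A * (τ (b j) ^ a * (τ (b i) * τ (b j) ^ (c + 1))) * word b C) =
        N (word b A * (τ (b i) * τ (b j) ^ p) * word b C) +
          ∑ d ∈ Finset.range a,
            N (word b A * (τ (b j) ^ d * τ ⁅b j, b i⁆ * τ (b j) ^ (p - 1 - d)) * word b C) := by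
    intro a
    induction a with
    | zero =>
      rintro c rfl
      simp
    | succ a ih =>
      intro c hc
      have h1 := hN.swap_word (A ++ List.replicate a j) (List.replicate (c + 1) j ++ C) hij (by
        have := wordLT_pow_swap A C hij (a + 1) c
        rw [hc] at this
        simpa [List.replicate_succ'] using this)
      have h2 : p - 1 - a = c + 1 := by omega
      rw [Finset.sum_range_succ, ← add_assoc, ← ih (c + 1) (by omega), h2]
      simpa [pow_succ' _ (c + 1), pow_succ _ a, mul_assoc] using h1
  have h0 := key (p - 1) 0 (by omega)
  have h1 := hN.ad_pow A C j (p - 1) ⁅b j, b i⁆ (by simp; omega)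
  have h2 := hN.pow_word (A ++ [i]) C j (by
    simpa [hq] using wordLT_pow_swap A C hij 0 (p - 1))
  have h3 := hN.swap A C (by simp; omega) (pPow k p (b j)) (b i)
  -- The bracket with `d = p - 1` comes from the swap rule in the goal and completes the sum to `(ad
  -- x_j) ^ (p - 1)` of `⁅x_j, x_i⁆`.
  have hs := Finset.sum_range_succ (fun d =>
    N (word b A * (τ (b j) ^ d * τ ⁅b j, b i⁆ * τ (b j) ^ (p - 1 - d)) * word b C)) (p - 1)
  rw [← sum_pow_mul_pow k hp, Finset.mul_sum, Finset.sum_mul, map_sum] at h1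
  rw [hq, h1, Nat.sub_self] at hs
  rw [lie_pPow_eq p hp] at h3
  simp only [word_append, word_replicate, word_cons, word_nil, mul_one, pow_one, zero_add, pow_zero,
    mul_assoc, mul_add, add_mul, map_add] at h0 h2 h3 hs ⊢
  rw [h3, h0, h2, hs, add_assoc]

/-- The overlap `x_j x_i ^ p`. -/
lemma RespectsBelow.resolve_swap_pow (hp : p.Prime) [CharP k p] (A C : List I) {i j : I}
    (hij : i < j) (hN : RespectsBelow b p N (A ++ j :: (List.replicate p i ++ C))) :
    N (word b A * (τ (b i) * τ (b j) + τ ⁅b j, b i⁆) *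
        word b (List.replicate (p - 1) i ++ C)) =
      N (word b (A ++ [j]) * τ (pPow k p (b i)) * word b C) := by
  have hp2 := hp.two_le
  have hq : p - 1 + 1 = p := by omega
  have key : ∀ a c, c + 1 + a = p →
      N (word b A * (τ (b i) ^ (c + 1) * (τ (b j) * τ (b i) ^ a)) * word b C) =
        N (word b A * (τ (b i) ^ p * τ (b j)) * word b C) +
          ∑ d ∈ Finset.range a, N (word b A *
            (τ (b i) ^ (p - 1 - d) * τ ⁅b j, b i⁆ * τ (b i) ^ d) * word b C) := by
    intro a
    induction a with
    | zero =>
      rintro c rfl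
      simp
    | succ a ih =>
      intro c hc
      have h1 := hN.swap_word (A ++ List.replicate (c + 1) i) (List.replicate a i ++ C) hij (by
        have := wordLT_swap_pow A C hij (a + 1) c
        rw [hc] at this
        simpa [List.replicate_succ (n := a)] using this)
      have h2 : p - 1 - a = c + 1 := by omega
      rw [Finset.sum_range_succ, ← add_assoc, ← ih (c + 1) (by omega), h2]
      simpa [pow_succ' _ a, pow_succ _ (c + 1), mul_assoc] using h1
  have h0 := key (p - 1) 0 (by omega)
  have h1 := hN.ad_pow A C i (p - 1) ⁅b j, b i⁆ (by simp; omega)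
  have h2 := hN.pow_word A (j :: C) i (by
    have := wordLT_swap_pow A C hij 0 (p - 1)
    simpa [hq] using this)
  have h3 := hN.swap A C (by simp; omega) (pPow k p (b i)) (b j)
  have hs := Finset.sum_range_succ (fun d =>
    N (word b A * (τ (b i) ^ (p - 1 - d) * τ ⁅b j, b i⁆ * τ (b i) ^ d) * word b C)) (p - 1)
  -- Here `x_j` moves right, so the exponents appear reversed; reflecting the index gives the sum of
  -- `sum_pow_mul_pow`.
  have hr := Finset.sum_range_reflect (fun d =>
    N (word b A * (τ (b i) ^ d * τ ⁅b j, b i⁆ * τ (b i) ^ (p - 1 - d)) * word b C)) p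
  have hr' : ∑ d ∈ Finset.range p,
      N (word b A * (τ (b i) ^ (p - 1 - d) * τ ⁅b j, b i⁆ * τ (b i) ^ d) * word b C) =
      ∑ d ∈ Finset.range p,
      N (word b A * (τ (b i) ^ d * τ ⁅b j, b i⁆ * τ (b i) ^ (p - 1 - d)) * word b C) := by
    rw [← hr]
    refine Finset.sum_congr rfl fun d hd => ?_
    have hd' := Finset.mem_range.1 hd
    rw [show p - 1 - (p - 1 - d) = d by omega]
  rw [← sum_pow_mul_pow k hp, Finset.mul_sum, Finset.sum_mul, map_sum] at h1
  rw [hq, hr', h1, Nat.sub_self] at hs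
  rw [lie_pPow_eq p hp, ← lie_skew (b i)] at h3
  simp only [word_append, word_replicate, word_cons, word_nil, mul_one, pow_one, zero_add, pow_zero,
    one_mul, mul_assoc, mul_add, add_mul, map_add, map_neg, neg_mul, mul_neg] at h0 h2 h3 hs ⊢
  rw [h0, h2, h3, hs]
  abel

/-- The overlap `x_i ^ (p + r)`. -/
lemma RespectsBelow.resolve_pow_pow (hp : p.Prime) (A C : List I) (i : I) (r : ℕ)
    (hN : RespectsBelow b p N (A ++ (List.replicate p i ++ (List.replicate r i ++ C)))) :
    N (word b A * τ (pPow k p (b i)) * word b (List.replicate r i ++ C)) =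
      N (word b (A ++ List.replicate r i) * τ (pPow k p (b i)) * word b C) := by
  have hp2 := hp.two_le
  have h0 : ⁅pPow k p (b i), b i⁆ = 0 := by rw [lie_pPow_eq p hp, lie_self, map_zero]
  have := hN.commute_pow A C i (pPow k p (b i)) h0 r (by simp; omega)
  simpa [mul_assoc] using this

end Resolvable

/-! ### Every ambiguity is disjoint, trivial or one of the overlaps above. -/

section Irreducible

variable {I k L M : Type*} [LinearOrder I] [Field k] [LieRing L] [LieAlgebra k L]
  [AddCommGroup M] [Module k M] {b : Module.Basis I k L} {p : ℕ} [RestrictedLieAlgebra k p L]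

lemma WordRule.mul_word {D : List I} {t : TensorAlgebra k L} (h : WordRule b p D t) (E : List I) :
    WordRule b p (D ++ E) (t * word b E) := by
  cases h with
  | swap A C h => simpa [mul_assoc] using WordRule.swap (b := b) (p := p) A (C ++ E) h
  | pow A C i => simpa [mul_assoc] using WordRule.pow (b := b) (p := p) A (C ++ E) i

lemma WordRule.word_mul {D : List I} {t : TensorAlgebra k L} (h : WordRule b p D t) (E : List I) :
    WordRule b p (E ++ D) (word b E * t) := by
  cases h with
  | swap A C h => simpa [mul_assoc] using WordRule.swap (b := b) (p := p) (E ++ A) C h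
  | pow A C i => simpa [mul_assoc] using WordRule.pow (b := b) (p := p) (E ++ A) C i

/-- Both sides reduce to `t₁ * t₂`: once one factor is rewritten it is a combination of smaller
words, and the rule for the other factor applies to each resulting product. -/
lemma RespectsBelow.resolve_disjoint (hp : p.Prime) {D₁ D₂ : List I} {t₁ t₂ : TensorAlgebra k L}
    (h₁ : WordRule b p D₁ t₁) (h₂ : WordRule b p D₂ t₂) {N : TensorAlgebra k L →ₗ[k] M}
    (hN : RespectsBelow b p N (D₁ ++ D₂)) : N (t₁ * word b D₂) = N (word b D₁ * t₂) := by
  trans N (t₁ * t₂)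
  · have key : Submodule.span k (wordBasis b '' {D' | WordLT D' D₁}) ≤ LinearMap.eqLocus
        (N ∘ₗ LinearMap.mulRight k (word b D₂)) (N ∘ₗ LinearMap.mulRight k t₂) := by
      rw [Submodule.span_le]
      rintro _ ⟨D', hD', rfl⟩
      have := hN (D' ++ D₂) _ (hD'.append_right D₂) (h₂.word_mul D')
      simpa using this
    exact key (h₁.mem_span b hp)
  · have key : Submodule.span k (wordBasis b '' {D' | WordLT D' D₂}) ≤ LinearMap.eqLocus
        (N ∘ₗ LinearMap.mulLeft k t₁) (N ∘ₗ LinearMap.mulLeft k (word b D₁)) := by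
      rw [Submodule.span_le]
      rintro _ ⟨D', hD', rfl⟩
      have := hN (D₁ ++ D') _ (hD'.append_left D₁) (h₁.mul_word D')
      simpa using this.symm
    exact key (h₂.mem_span b hp)

/-- The cut falls either after the block of `i`s or before its end. Requiring `m ≠ 0` puts a cut
exactly at the end in the first case, where the rules do not overlap. -/
lemma replicate_append_eq_append {α : Type*} {i : α} {n : ℕ} {B C W : List α}
    (h : List.replicate n i ++ C = B ++ W) :
    (∃ B', B = List.replicate n i ++ B' ∧ C = B' ++ W) ∨
      ∃ r m, m ≠ 0 ∧ r + m = n ∧ B = List.replicate r i ∧ W = List.replicate m i ++ C := by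
  rcases List.append_eq_append_iff.1 h with ⟨B', h1, h2⟩ | ⟨E, h1, h2⟩
  · exact Or.inl ⟨B', h1, h2⟩
  · obtain ⟨hl, hB, hE⟩ := List.replicate_eq_append_iff.1 h1
    rcases eq_or_ne E.length 0 with h0 | h0
    · left
      rw [List.length_eq_zero_iff] at h0
      subst h0
      exact ⟨[], by simpa using h1.symm, by simpa using h2.symm⟩
    · right
      exact ⟨B.length, E.length, h0, hl, hB, by rw [h2, ← hE]⟩

/-- Of two left contexts of one word, one is a prefix of the other. So it suffices to treat the four
pairs of rule types with contexts `A` and `A ++ B`, and to exchange the rules otherwise. -/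
lemma RespectsBelow.resolve (hp : p.Prime) [CharP k p] {D : List I} {t₁ t₂ : TensorAlgebra k L}
    (h₁ : WordRule b p D t₁) (h₂ : WordRule b p D t₂) {N : TensorAlgebra k L →ₗ[k] M}
    (hN : RespectsBelow b p N D) : N t₁ = N t₂ := by
  have hp2 := hp.two_le
  have swap_swap : ∀ (A B C C' : List I) (i j i' j' : I), i < j → i' < j' →
      j :: i :: C = B ++ j' :: i' :: C' → RespectsBelow b p N (A ++ j :: i :: C) →
      N (word b A * (TensorAlgebra.ι k (b i) * TensorAlgebra.ι k (b j) +
        TensorAlgebra.ι k ⁅b j, b i⁆) * word b C) =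
      N (word b (A ++ B) * (TensorAlgebra.ι k (b i') * TensorAlgebra.ι k (b j') +
        TensorAlgebra.ι k ⁅b j', b i'⁆) * word b C') := by
    intro A B C C' i j i' j' h h' e hN
    match B, e with
    | [], e => simp only [List.nil_append, List.cons.injEq] at e; obtain ⟨rfl, rfl, rfl⟩ := e; simp
    | [x], e =>
      simp only [List.cons_append, List.nil_append, List.cons.injEq] at e
      obtain ⟨rfl, rfl, rfl⟩ := e
      exact hN.resolve_swap_swap A C' h' h
    | x :: y :: B, e =>
      simp only [List.cons_append, List.cons.injEq] at e
      obtain ⟨rfl, rfl, rfl⟩ := e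
      have := RespectsBelow.resolve_disjoint hp (.swap A B h) (.swap [] C' h') (N := N)
        (by simpa using hN)
      simpa [mul_assoc] using this
  have swap_pow : ∀ (A B C C' : List I) (i j l : I), i < j →
      j :: i :: C = B ++ (List.replicate p l ++ C') → RespectsBelow b p N (A ++ j :: i :: C) →
      N (word b A * (TensorAlgebra.ι k (b i) * TensorAlgebra.ι k (b j) +
        TensorAlgebra.ι k ⁅b j, b i⁆) * word b C) =
      N (word b (A ++ B) * TensorAlgebra.ι k (pPow k p (b l)) * word b C') := by
    intro A B C C' i j l h e hN
    obtain ⟨q, hq⟩ : ∃ q, p = q + 2 := ⟨p - 2, by omega⟩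
    match B, e with
    | [], e =>
      rw [show List.replicate p l = l :: l :: List.replicate q l by
        rw [hq, List.replicate_succ, List.replicate_succ]] at e
      simp only [List.nil_append, List.cons_append, List.cons.injEq] at e
      obtain ⟨rfl, rfl, rfl⟩ := e
      -- A swap and a power cannot start at the same letter, as the power would force `i = j`.
      exact absurd h (lt_irrefl _)
    | [x], e =>
      have hr : List.replicate p l = l :: List.replicate (p - 1) l := by
        rw [← List.replicate_succ, Nat.sub_add_cancel hp.one_le]
      rw [hr] at e
      simp only [List.nil_append, List.cons_append, List.cons.injEq] at e
      obtain ⟨rfl, rfl, rfl⟩ := e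
      exact RespectsBelow.resolve_swap_pow hp A C' h (by rw [hr]; simpa using hN)
    | x :: y :: B, e =>
      simp only [List.cons_append, List.cons.injEq] at e
      obtain ⟨rfl, rfl, rfl⟩ := e
      have := RespectsBelow.resolve_disjoint hp (.swap A B h) (.pow [] C' l) (N := N)
        (by simpa using hN)
      simpa [mul_assoc] using this
  have pow_swap : ∀ (A B C C' : List I) (i j l : I), i < j →
      List.replicate p l ++ C = B ++ j :: i :: C' →
      RespectsBelow b p N (A ++ (List.replicate p l ++ C)) →
      N (word b A * TensorAlgebra.ι k (pPow k p (b l)) * word b C) =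
      N (word b (A ++ B) * (TensorAlgebra.ι k (b i) * TensorAlgebra.ι k (b j) +
        TensorAlgebra.ι k ⁅b j, b i⁆) * word b C') := by
    intro A B C C' i j l h e hN
    rcases replicate_append_eq_append e with ⟨B', rfl, rfl⟩ | ⟨r, m, hm, hrm, rfl, e'⟩
    · have := RespectsBelow.resolve_disjoint hp (.pow A B' l) (.swap [] C' h) (N := N)
        (by simpa using hN)
      simpa [mul_assoc] using this
    · match m, hm with
      | 1, _ =>
        simp only [List.replicate_one, List.cons_append, List.nil_append, List.cons.injEq] at e'
        obtain ⟨rfl, rfl⟩ := e'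
        obtain rfl : r = p - 1 := by omega
        exact RespectsBelow.resolve_pow_swap hp A C' h hN
      | m + 2, _ =>
        simp only [List.replicate_succ, List.cons_append, List.cons.injEq] at e'
        obtain ⟨rfl, rfl, -⟩ := e'
        -- Two or more letters shared with the power would make the descent `j, i` constant.
        exact absurd h (lt_irrefl _)
  have pow_pow : ∀ (A B C C' : List I) (i l : I),
      List.replicate p l ++ C = B ++ (List.replicate p i ++ C') →
      RespectsBelow b p N (A ++ (List.replicate p l ++ C)) →
      N (word b A * TensorAlgebra.ι k (pPow k p (b l)) * word b C) =
      N (word b (A ++ B) * TensorAlgebra.ι k (pPow k p (b i)) * word b C') := by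
    intro A B C C' i l e hN
    rcases replicate_append_eq_append e with ⟨B', rfl, rfl⟩ | ⟨r, m, hm, hrm, rfl, e'⟩
    · have := RespectsBelow.resolve_disjoint hp (.pow A B' l) (.pow [] C' i) (N := N)
        (by simpa using hN)
      simpa [mul_assoc] using this
    · obtain ⟨m, rfl⟩ := Nat.exists_eq_succ_of_ne_zero hm
      obtain rfl : i = l := by
        have hpr : List.replicate p i = i :: List.replicate (p - 1) i := by
          rw [← List.replicate_succ, Nat.sub_add_cancel hp.one_le]
        rw [hpr] at e'
        simp only [List.replicate_succ, List.cons_append, List.cons.injEq] at e'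
        exact e'.1
      have hC : C = List.replicate r i ++ C' := by
        rw [show List.replicate p i = List.replicate (m + 1) i ++ List.replicate r i by
          rw [List.replicate_append_replicate]; congr 1; omega, List.append_assoc] at e'
        exact (List.append_cancel_left e').symm
      subst hC
      exact RespectsBelow.resolve_pow_pow hp A C' i r hN
  rcases h₁ with ⟨A, C, h⟩ | ⟨A, C, l⟩
  · generalize hD : A ++ _ = D at h₂
    rcases h₂ with ⟨A', C', h'⟩ | ⟨A', C', l'⟩
    · rcases List.append_eq_append_iff.1 hD with ⟨B, rfl, e⟩ | ⟨B, rfl, e⟩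
      · exact swap_swap A B C C' _ _ _ _ h h' e hN
      · exact (swap_swap A' B C' C _ _ _ _ h' h e (hD ▸ hN)).symm
    · rcases List.append_eq_append_iff.1 hD with ⟨B, rfl, e⟩ | ⟨B, rfl, e⟩
      · exact swap_pow A B C C' _ _ _ h e hN
      · exact (pow_swap A' B C' C _ _ _ h e (hD ▸ hN)).symm
  · generalize hD : A ++ _ = D at h₂
    rcases h₂ with ⟨A', C', h'⟩ | ⟨A', C', l'⟩
    · rcases List.append_eq_append_iff.1 hD with ⟨B, rfl, e⟩ | ⟨B, rfl, e⟩
      · exact pow_swap A B C C' _ _ _ h' e hN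
      · exact (swap_pow A' B C' C _ _ _ h' e (hD ▸ hN)).symm
    · rcases List.append_eq_append_iff.1 hD with ⟨B, rfl, e⟩ | ⟨B, rfl, e⟩
      · exact pow_pow A B C C' _ _ e hN
      · exact (pow_pow A' B C' C _ _ e (hD ▸ hN)).symm

end Irreducible

/-! ### Normal words and their independence in the enveloping algebra. -/

section NormalForm

variable {I k L : Type*} [LinearOrder I] [Field k] [LieRing L] [LieAlgebra k L]
  {b : Module.Basis I k L} {p : ℕ} [RestrictedLieAlgebra k p L]

/-- The words that cannot be rewritten: the nondecreasing ones in which every letter occurs fewer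
than `p` times. -/
def IsNormalWord (p : ℕ) (D : List I) : Prop :=
  D.Pairwise (· ≤ ·) ∧ ∀ i, D.count i < p

lemma IsNormalWord.sublist {D E : List I} (h : IsNormalWord p D) (hE : E.Sublist D) :
    IsNormalWord p E :=
  ⟨h.1.sublist hE, fun i => (hE.count_le i).trans_lt (h.2 i)⟩

lemma isNormalWord_singleton (hp : p.Prime) (i : I) : IsNormalWord p [i] :=
  ⟨List.pairwise_singleton _ _, fun _ => (List.count_le_length).trans_lt hp.one_lt⟩

lemma isNormalWord_nil (hp : p.Prime) : IsNormalWord p ([] : List I) :=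
  ⟨.nil, fun _ => (List.count_le_length).trans_lt hp.pos⟩

lemma IsNormalWord.not_wordRule {D : List I} (h : IsNormalWord p D) (t : TensorAlgebra k L) :
    ¬ WordRule b p D t := by
  rintro (⟨A, C, hij⟩ | ⟨A, C, i⟩)
  · have h1 := List.pairwise_append.1 h.1
    exact hij.not_ge ((List.pairwise_cons.1 h1.2.1).1 _ (by simp))
  · have := h.2 i
    simp at this
    omega

lemma replicate_prefix_of_le_count {D : List I} (hD : D.Pairwise (· ≤ ·)) (i : I)
    (hi : ∀ d ∈ D, i ≤ d) {n : ℕ} (h : n ≤ D.count i) : List.replicate n i <+: D := by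
  induction D generalizing n with
  | nil =>
    obtain rfl : n = 0 := by simpa using h
    simp
  | cons d D ih =>
    rw [List.pairwise_cons] at hD
    cases n with
    | zero => simp
    | succ n =>
      rcases (hi d (by simp)).eq_or_lt with rfl | hd
      · rw [List.replicate_succ, List.prefix_cons_inj]
        exact ih hD.2 hD.1 (by simpa using h)
      · have h0 : (d :: D).count i = 0 := List.count_eq_zero.2 fun hm => by
          rcases List.mem_cons.1 hm with rfl | hm
          · exact lt_irrefl _ hd
          · exact (hD.1 _ hm).not_gt hd
        omega

/-- Equal letters of a sorted word are adjacent, so `p` occurrences already make the power rule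
applicable. -/
lemma exists_replicate_of_le_count {D : List I} (hD : D.Pairwise (· ≤ ·)) (i : I) {n : ℕ}
    (h : n ≤ D.count i) : ∃ A C, D = A ++ (List.replicate n i ++ C) := by
  induction D with
  | nil =>
    obtain rfl : n = 0 := by simpa using h
    exact ⟨[], [], rfl⟩
  | cons d D ih =>
    by_cases hd : d = i
    · subst hd
      obtain ⟨C, hC⟩ := replicate_prefix_of_le_count hD d
        (by simpa using (List.pairwise_cons.1 hD).1) h
      exact ⟨[], C, hC.symm⟩
    · rw [List.count_cons_of_ne hd] at h
      obtain ⟨A, C, rfl⟩ := ih (List.pairwise_cons.1 hD).2 h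
      exact ⟨d :: A, C, rfl⟩

lemma exists_wordRule {D : List I} (h : ¬ IsNormalWord p D) :
    ∃ t : TensorAlgebra k L, WordRule b p D t := by
  by_cases hD : D.Pairwise (· ≤ ·)
  · obtain ⟨i, hi⟩ : ∃ i, p ≤ D.count i := by
      by_contra! hc
      exact h ⟨hD, hc⟩
    obtain ⟨A, C, rfl⟩ := exists_replicate_of_le_count hD i hi
    exact ⟨_, .pow A C i⟩
  · rw [← List.isChain_iff_pairwise, List.isChain_iff_forall_rel_of_append_cons_cons] at hD
    push Not at hD
    obtain ⟨j, i, A, C, rfl, hij⟩ := hD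
    exact ⟨_, .swap A C hij⟩

variable (b p) in
lemma exists_normalForm_tensorAlgebra (hp : p.Prime) [CharP k p] :
    ∃ N : TensorAlgebra k L →ₗ[k] (List I →₀ k),
      (∀ D t, WordRule b p D t → N (word b D) = N t) ∧
      ∀ D, IsNormalWord p D → N (word b D) = Finsupp.single D 1 := by
  obtain ⟨N, h1, h2⟩ := exists_linearMap_of_resolvable (wordBasis b) WordLT wordLT_wellFounded
    (WordRule b p) (fun D t h => h.mem_span b hp)
    (fun D t₁ t₂ h₁ h₂ (N : TensorAlgebra k L →ₗ[k] (List I →₀ k)) hN =>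
      RespectsBelow.resolve hp h₁ h₂ (N := N) fun D' t' hD ht => by simpa using hN D' t' hD ht)
    (fun D => Finsupp.single D 1)
  refine ⟨N, fun D t h => by simpa using h1 D t h, fun D h => ?_⟩
  simpa using h2 D fun t => h.not_wordRule t

/-- The largest ring congruence that is contained in the kernel of a linear map `N`. -/
def ringConOfLinearMap {T M : Type*} [Ring T] [Algebra k T] [AddCommGroup M] [Module k M]
    (N : T →ₗ[k] M) : RingCon T where
  r s t := ∀ u v, N (u * s * v) = N (u * t * v)
  iseqv := ⟨fun _ _ _ => rfl, fun h u v => (h u v).symm, fun h h' u v => (h u v).trans (h' u v)⟩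
  add' h h' u v := by simp only [mul_add, add_mul, map_add, h u v, h' u v]
  mul' {s s' t t'} h h' u v := by
    have h1 := h u (t * v)
    have h2 := h' (u * s') v
    simp only [mul_assoc] at h1 h2 ⊢
    rw [h1, h2]

lemma ringConOfLinearMap_of_word {J M : Type*} [AddCommGroup M] [Module k M]
    (b : Module.Basis J k L)
    {N : TensorAlgebra k L →ₗ[k] M} {s t : TensorAlgebra k L}
    (h : ∀ A C, N (word b A * s * word b C) = N (word b A * t * word b C)) :
    ringConOfLinearMap N s t := by
  intro u v
  have h1 : ∀ A, N ∘ₗ LinearMap.mulLeft k (word b A * s) = N ∘ₗ LinearMap.mulLeft k (word b A * t) :=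
    fun A => (wordBasis b).ext fun C => by simpa [mul_assoc] using h A C
  have h2 : N ∘ₗ LinearMap.mulRight k (s * v) = N ∘ₗ LinearMap.mulRight k (t * v) :=
    (wordBasis b).ext fun A => by simpa [mul_assoc] using DFunLike.congr_fun (h1 A) v
  simpa [mul_assoc] using DFunLike.congr_fun h2 u

lemma pPow_zero (hp : p.Prime) : pPow k p (0 : L) = 0 := by
  have h := RestrictedLieAlgebra.pMap_smul (k := k) (p := p) (0 : k) (0 : L)
  rwa [zero_smul, zero_pow hp.ne_zero, zero_smul] at h

/-- A Lie algebra morphism to an associative algebra is compatible with `p`-maps if it is so on a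
basis. -/
lemma map_pPow_of_basis {J : Type*} (b : Module.Basis J k L) (hp : p.Prime) [CharP k p] {A : Type*} [Ring A] [Algebra k A]
    (f : L →ₗ⁅k⁆ A) (h : ∀ i, f (pPow k p (b i)) = f (b i) ^ p) (x : L) :
    f (pPow k p x) = f x ^ p := by
  have hx : x ∈ Submodule.span k (Set.range b) := by rw [b.span_eq]; trivial
  induction hx using Submodule.span_induction with
  | mem x hx => obtain ⟨i, rfl⟩ := hx; exact h i
  | zero => rw [pPow_zero hp, map_zero, zero_pow hp.ne_zero]
  -- Jacobson's formula in `A` has the same correction term as the `p`-map of `L`, since Lie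
  -- morphisms preserve `jacobsonSum`.
  | add x y _ _ hx hy =>
    rw [pPow, RestrictedLieAlgebra.pMap_add, map_add, map_add, hx, hy, map_jacobsonSum, map_add,
      jacobson_add_pow k p hp]
  | smul a x _ hx =>
    rw [pPow, RestrictedLieAlgebra.pMap_smul, map_smul, hx, map_smul, _root_.smul_pow]

/-- The product in the restricted enveloping algebra of a word in the basis vectors. -/
noncomputable def envelopingWord (b : Module.Basis I k L) (p : ℕ) [RestrictedLieAlgebra k p L]
    (D : List I) : RestrictedEnveloping k p L :=
  (D.map fun i => RestrictedEnveloping.ι k p (b i)).prod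

lemma ringConOfLinearMap_lie {M : Type*} [AddCommGroup M] [Module k M]
    {N : TensorAlgebra k L →ₗ[k] M} (hN : ∀ D t, WordRule b p D t → N (word b D) = N t) (x y : L) :
    ringConOfLinearMap N (TensorAlgebra.ι k x * TensorAlgebra.ι k y)
      (TensorAlgebra.ι k y * TensorAlgebra.ι k x + TensorAlgebra.ι k ⁅x, y⁆) := by
  rcases isEmpty_or_nonempty I with hI | ⟨⟨i⟩⟩
  · obtain rfl : x = y := b.ext_elem fun i => isEmptyElim i
    simpa using (ringConOfLinearMap N).refl _
  · refine ringConOfLinearMap_of_word b fun A C => ?_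
    -- Now `N` respects all rules, so any word serves as a bound; this one just exceeds the length
    -- `|A| + |C| + 2` required by `swap`. It needs a letter, hence the separate case `L = 0`.
    have h : RespectsBelow b p N (List.replicate (A.length + C.length + 3) i) :=
      fun D t _ => hN D t
    rw [mul_add, add_mul, map_add]
    exact h.swap A C (by simp) x y

variable (b p) in
/-- The normal words are linearly independent in the restricted enveloping algebra. -/
theorem exists_normalForm (hp : p.Prime) [CharP k p] :
    ∃ ν : RestrictedEnveloping k p L →ₗ[k] (List I →₀ k),
      ∀ D, IsNormalWord p D → ν (envelopingWord b p D) = Finsupp.single D 1 := by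
  obtain ⟨N, hN, hN'⟩ := exists_normalForm_tensorAlgebra b p hp
  -- The quotient by `c` is an algebra satisfying the relations of the enveloping algebra, and `N`
  -- still factors through it.
  let c := ringConOfLinearMap N
  let q : TensorAlgebra k L →ₐ[k] c.Quotient := c.mkₐ k
  have hq : ∀ {s t}, q s = q t ↔ c s t := fun {s t} => RingCon.eq c
  have hqs : Function.Surjective q := Quotient.mk''_surjective
  let f : L →ₗ⁅k⁆ c.Quotient :=
    { q.toLinearMap ∘ₗ TensorAlgebra.ι k with
      map_lie' := fun {x y} => by
        change q _ = ⁅q _, q _⁆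
        rw [LieRing.of_associative_ring_bracket, eq_sub_iff_add_eq', ← map_mul q, ← map_mul q,
          ← map_add q]
        exact (hq.2 (ringConOfLinearMap_lie hN x y)).symm }
  have hf : ∀ x, f (pPow k p x) = f x ^ p := map_pPow_of_basis b hp f fun i => by
    change q _ = q _ ^ p
    rw [← map_pow, hq]
    refine ringConOfLinearMap_of_word b fun A C => ?_
    rw [← hN _ _ (.pow A C i)]
    simp [mul_assoc]
  -- A linear section descends `N` to the quotient; congruence with both multipliers equal to `1`
  -- shows `N ∘ σ ∘ q = N`.
  obtain ⟨σ, hσ⟩ := q.toLinearMap.exists_rightInverse_of_surjective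
    (LinearMap.range_eq_top.2 hqs)
  have hNσ : ∀ t, N (σ (q t)) = N t := fun t => by
    have h : c (σ (q t)) t := hq.1 (DFunLike.congr_fun hσ (q t))
    simpa using h 1 1
  refine ⟨N ∘ₗ σ ∘ₗ (RestrictedEnveloping.lift f hf).toLinearMap, fun D hD => ?_⟩
  have h : RestrictedEnveloping.lift f hf (envelopingWord b p D) = q (word b D) := by
    rw [envelopingWord, word, map_list_prod, map_list_prod, List.map_map, List.map_map]
    congr 1
    exact List.map_congr_left fun i _ => RestrictedEnveloping.lift_ι f hf (b i)
  simp only [LinearMap.comp_apply, AlgHom.toLinearMap_apply, h, hNσ, hN' D hD]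

end NormalForm

/-! ### Combinatorics of the comultiplication of a word. -/

section Splits

/-- All ways to split a list into two complementary sublists. -/
def splits {α : Type*} : List α → List (List α × List α)
  | [] => [([], [])]
  | a :: l => (splits l).map (fun s => (a :: s.1, s.2)) ++ (splits l).map fun s => (s.1, a :: s.2)

lemma sublist_of_mem_splits {α : Type*} {l : List α} {s : List α × List α} (h : s ∈ splits l) :
    s.2.Sublist l := by
  induction l generalizing s with
  | nil => simp_all [splits]
  | cons a l ih =>
    simp only [splits, List.mem_append, List.mem_map] at h
    rcases h with ⟨s, hs, rfl⟩ | ⟨s, hs, rfl⟩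
    · exact (ih hs).cons a
    · exact (ih hs).cons_cons a

lemma sum_splits_nil {α M : Type*} [DecidableEq α] [AddCommMonoid M] (f : List α → M)
    (l : List α) : ((splits l).map fun s => if s.2 = [] then f s.1 else 0).sum = f l := by
  induction l generalizing f with
  | nil => simp [splits]
  | cons a l ih => simpa [splits, Function.comp_def] using ih fun t => f (a :: t)

/-- Each occurrence of `i` gives one such split. Sortedness makes the occurrences adjacent, so
removing any of them leaves the same word. -/
lemma sum_splits_singleton {α M : Type*} [LinearOrder α] [AddCommMonoid M] (f : List α → M)
    (i : α) (l : List α) (hl : l.Pairwise (· ≤ ·)) :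
    ((splits l).map fun s => if s.2 = [i] then f s.1 else 0).sum = l.count i • f (l.erase i) := by
  induction l generalizing f with
  | nil => simp [splits]
  | cons a l ih =>
    rw [List.pairwise_cons] at hl
    have h1 := ih (fun t => f (a :: t)) hl.2
    have h2 := sum_splits_nil f l
    simp only [splits, List.map_append, List.map_map, List.sum_append, Function.comp_def,
      List.cons.injEq]
    rw [h1]
    by_cases h : a = i
    · subst h
      simp only [true_and, h2, List.count_cons_self, List.erase_cons_head]
      rw [add_smul, one_smul]
      congr 1
      by_cases ha : a ∈ l
      · obtain ⟨d, D, rfl⟩ := List.exists_cons_of_ne_nil (List.ne_nil_of_mem ha)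
        obtain rfl : a = d := by
          refine le_antisymm (hl.1 d (by simp)) ?_
          rcases List.mem_cons.1 ha with rfl | ha
          · exact le_rfl
          · exact (List.pairwise_cons.1 hl.2).1 a ha
        simp
      · simp [List.count_eq_zero.2 ha]
    · simp [h, List.count_cons_of_ne h]

end Splits

/-! ### Primitive elements of the restricted enveloping algebra. -/

section PrimitiveElements

variable {I k L : Type*} [Field k] [LieRing L] [LieAlgebra k L]
  {b : Module.Basis I k L} {p : ℕ} [RestrictedLieAlgebra k p L]

@[simp] lemma envelopingWord_nil : envelopingWord b p [] = 1 := rfl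

@[simp] lemma envelopingWord_cons (i : I) (D : List I) : envelopingWord b p (i :: D) =
    RestrictedEnveloping.ι k p (b i) * envelopingWord b p D := by simp [envelopingWord]

variable (k p L) in
/-- The canonical map from the tensor algebra to the restricted enveloping algebra. -/
noncomputable def tensorToEnveloping : TensorAlgebra k L →ₐ[k] RestrictedEnveloping k p L :=
  TensorAlgebra.lift k
    ((RestrictedEnveloping.ι k p : L →ₗ⁅k⁆ RestrictedEnveloping k p L) : L →ₗ[k] _)

@[simp] lemma tensorToEnveloping_ι (x : L) :
    tensorToEnveloping k L p (TensorAlgebra.ι k x) = RestrictedEnveloping.ι k p x :=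
  TensorAlgebra.lift_ι_apply _ x

lemma tensorToEnveloping_word (D : List I) :
    tensorToEnveloping k L p (word b D) = envelopingWord b p D := by
  rw [word, map_list_prod, List.map_map, envelopingWord]
  congr 1
  exact List.map_congr_left fun i _ => tensorToEnveloping_ι (b i)

variable (k p L) in
lemma tensorToEnveloping_surjective : Function.Surjective (tensorToEnveloping k L p) := by
  have h : tensorToEnveloping k L p =
      (RestrictedEnveloping.mk k p L).comp (UniversalEnvelopingAlgebra.mkAlgHom k L) :=
    TensorAlgebra.hom_ext (LinearMap.ext fun x => tensorToEnveloping_ι x)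
  rw [h]
  have h' : Function.Surjective (UniversalEnvelopingAlgebra.mkAlgHom k L) :=
    Quotient.mk''_surjective
  exact (RingQuot.mkAlgHom_surjective k _).comp h'

variable [LinearOrder I]

lemma WordRule.tensorToEnveloping_eq {D : List I} {t : TensorAlgebra k L}
    (h : WordRule b p D t) : tensorToEnveloping k L p (word b D) = tensorToEnveloping k L p t := by
  cases h with
  | swap A C h => simp [LieRing.of_associative_ring_bracket, mul_assoc]
  | pow A C i => simp [RestrictedEnveloping.ι_pPow, mul_assoc]

lemma span_normalWord (hp : p.Prime) :
    Submodule.span k (envelopingWord b p '' {D | IsNormalWord p D}) = ⊤ := by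
  set S := Submodule.span k (envelopingWord b p '' {D | IsNormalWord p D})
  have h1 : ∀ D, tensorToEnveloping k L p (word b D) ∈ S := by
    intro D
    induction D using (wordLT_wellFounded (I := I)).induction
    rename_i D ih
    by_cases hD : IsNormalWord p D
    · exact Submodule.subset_span ⟨D, hD, (tensorToEnveloping_word D).symm⟩
    · obtain ⟨t, ht⟩ := exists_wordRule (b := b) hD
      rw [ht.tensorToEnveloping_eq]
      have : Submodule.span k (wordBasis b '' {D' | WordLT D' D}) ≤
          S.comap (tensorToEnveloping k L p).toLinearMap := by
        rw [Submodule.span_le]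
        rintro _ ⟨D', hD', rfl⟩
        simpa using ih D' hD'
      exact this (ht.mem_span b hp)
  rw [eq_top_iff]
  intro z _
  obtain ⟨t, rfl⟩ := tensorToEnveloping_surjective k L p z
  have h2 : Submodule.span k (Set.range (wordBasis b)) ≤
      S.comap (tensorToEnveloping k L p).toLinearMap := by
    rw [Submodule.span_le]
    rintro _ ⟨D, rfl⟩
    simpa using h1 D
  rw [(wordBasis b).span_eq] at h2
  exact h2 trivial

lemma linearMap_ext_normalWord (hp : p.Prime) {M : Type*} [AddCommGroup M] [Module k M]
    {f g : RestrictedEnveloping k p L →ₗ[k] M}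
    (h : ∀ D, IsNormalWord p D → f (envelopingWord b p D) = g (envelopingWord b p D)) : f = g := by
  refine LinearMap.ext_on (span_normalWord (b := b) hp) ?_
  rintro _ ⟨D, hD, rfl⟩
  exact h D hD

variable [Fact p.Prime] [CharP k p]

/-- Comultiplication is multiplicative and each letter is primitive, so every letter independently
goes to one of the two tensor factors. -/
lemma comul_envelopingWord {J : Type*} {b : Module.Basis J k L} (D : List J) :
    Coalgebra.comul (R := k) (envelopingWord b p D) =
      ((splits D).map fun s => envelopingWord b p s.1 ⊗ₜ[k] envelopingWord b p s.2).sum := by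
  induction D with
  | nil => simp [splits, Bialgebra.comul_one, Algebra.TensorProduct.one_def]
  | cons d D ih =>
    have h := mem_primitives.1 (RestrictedEnveloping.ι_mem_primitives k p (b d))
    rw [envelopingWord_cons, Bialgebra.comul_mul, h, ih, add_mul, ← List.sum_map_mul_left,
      ← List.sum_map_mul_left]
    simp [splits, Function.comp_def]

lemma counit_envelopingWord {J : Type*} {b : Module.Basis J k L} (D : List J) :
    Coalgebra.counit (R := k) (envelopingWord b p D) = if D = [] then 1 else 0 := by
  cases D with
  | nil => simp
  | cons d D => simp [RestrictedEnveloping.counit_ι]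

/-- Contraction of the comultiplication with a linear form. -/
noncomputable def contractComul {B : Type*} [Ring B] [Bialgebra k B] (φ : B →ₗ[k] k) : B →ₗ[k] B :=
  (TensorProduct.rid k B).toLinearMap ∘ₗ φ.lTensor B ∘ₗ Coalgebra.comul

lemma contractComul_primitive {B : Type*} [Ring B] [Bialgebra k B] (φ : B →ₗ[k] k) {z : B}
    (hz : z ∈ primitives k B) : contractComul φ z = φ 1 • z + φ z • 1 := by
  simp [contractComul, mem_primitives.1 hz]

/-- The partial derivative along `x_i`. Knowing `φ` on normal words is enough, since subwords of
normal words are normal. -/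
lemma contractComul_envelopingWord (φ : RestrictedEnveloping k p L →ₗ[k] k) (i : I)
    (hφ : ∀ D, IsNormalWord p D → φ (envelopingWord b p D) = if D = [i] then 1 else 0)
    {D : List I} (hD : IsNormalWord p D) :
    contractComul φ (envelopingWord b p D) = (D.count i : k) • envelopingWord b p (D.erase i) := by
  rw [Nat.cast_smul_eq_nsmul, ← sum_splits_singleton _ i D hD.1, contractComul, LinearMap.comp_apply, LinearMap.comp_apply,
    comul_envelopingWord, map_list_sum, map_list_sum, List.map_map, List.map_map]
  congr 1
  refine List.map_congr_left fun s hs => ?_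
  simp [hφ _ (hD.sublist (sublist_of_mem_splits hs))]

lemma unitHom_bijective_of_basis (b : Module.Basis I k L) (p : ℕ) [RestrictedLieAlgebra k p L]
    [Fact p.Prime] [CharP k p] :
    Function.Bijective (RestrictedEnveloping.unitHom k p L).toLieHom := by
  have hp : p.Prime := Fact.out
  obtain ⟨ν, hν⟩ := exists_normalForm b p hp
  have hν1 : ν 1 = Finsupp.single [] 1 := hν [] (isNormalWord_nil hp)
  have hνι : ∀ i, ν (RestrictedEnveloping.ι k p (b i)) = Finsupp.single [i] 1 := fun i => by
    simpa using hν [i] (isNormalWord_singleton hp i)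
  -- the projection of the enveloping algebra onto the Lie algebra
  let π : RestrictedEnveloping k p L →ₗ[k] L :=
    Finsupp.linearCombination k (fun D : List _ => match D with | [i] => b i | _ => 0) ∘ₗ ν
  have hπ : π ∘ₗ ((RestrictedEnveloping.ι k p : L →ₗ⁅k⁆ RestrictedEnveloping k p L) : L →ₗ[k] _) =
      .id :=
    b.ext fun i => by simp [π, hνι]
  refine ⟨fun x y h => ?_, fun ⟨z, hz⟩ => ?_⟩
  · have h' : RestrictedEnveloping.ι k p x = RestrictedEnveloping.ι k p y := congrArg Subtype.val h
    exact (DFunLike.congr_fun hπ x).symm.trans ((congrArg π h').trans (DFunLike.congr_fun hπ y))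
  · refine ⟨π z, Subtype.ext ?_⟩
    change RestrictedEnveloping.ι k p (π z) = z
    have h0 : ν z [] = 0 := by
      have h : Finsupp.lapply [] ∘ₗ ν = Coalgebra.counit (R := k) :=
        linearMap_ext_normalWord (b := b) hp fun D hD => by
          simp [hν D hD, counit_envelopingWord, Finsupp.single_apply]
      exact (DFunLike.congr_fun h z).trans (counit_eq_zero_of_mem_primitives hz)
    have h2 : ∀ i j E, IsNormalWord p (i :: j :: E) → ν z (i :: j :: E) = 0 := by
      intro i j E hD
      let φ : RestrictedEnveloping k p L →ₗ[k] k := Finsupp.lapply [i] ∘ₗ ν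
      have hφ : ∀ D, IsNormalWord p D → φ (envelopingWord b p D) = if D = [i] then 1 else 0 :=
        fun D hD => by simp [φ, hν D hD, Finsupp.single_apply]
      -- Only the normal word `i :: j :: E` has derivative along `x_i` involving `j :: E`: a sorted
      -- word is determined by its letters.
      have h : Finsupp.lapply (j :: E) ∘ₗ ν ∘ₗ contractComul φ =
          ((i :: j :: E).count i : k) • (Finsupp.lapply (i :: j :: E) ∘ₗ ν) := by
        refine linearMap_ext_normalWord (b := b) hp fun D hD' => ?_
        have hE : IsNormalWord p (D.erase i) := hD'.sublist List.erase_sublist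
        simp only [LinearMap.comp_apply, LinearMap.smul_apply,
          contractComul_envelopingWord φ i hφ hD', map_smul, hν _ hE, hν _ hD',
          Finsupp.lapply_apply, Finsupp.single_apply, smul_eq_mul]
        by_cases hi : i ∈ D
        · have hiff : D.erase i = j :: E ↔ D = i :: j :: E := by
            constructor
            · intro h
              have hperm : D.Perm (i :: j :: E) := h ▸ List.perm_cons_erase hi
              exact hperm.eq_of_pairwise' hD'.1 hD.1
            · rintro rfl
              simp
          by_cases hDE : D = i :: j :: E
          · subst hDE
            simp
          · simp [hDE, hiff.not.2 hDE]
        · have hDE : D ≠ i :: j :: E := by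
            rintro rfl
            simp at hi
          simp [hDE, List.count_eq_zero.2 hi]
      have hz' := DFunLike.congr_fun h z
      simp only [LinearMap.comp_apply, LinearMap.smul_apply, contractComul_primitive φ hz, map_add,
        map_smul, hν1, φ, Finsupp.lapply_apply, smul_eq_mul, Finsupp.single_apply] at hz'
      -- The exponent lies between `1` and `p - 1`. This is where the truncation at `p` matters.
      have hc : ((i :: j :: E).count i : k) ≠ 0 := by
        rw [Ne, CharP.cast_eq_zero_iff k p]
        intro hdvd
        have h1 := Nat.le_of_dvd (by simp) hdvd
        exact (hD.2 i).not_ge h1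
      refine (mul_eq_zero.1 (hz'.symm.trans ?_)).resolve_left hc
      simp
    have hz' : Finsupp.linearCombination k (envelopingWord b p) (ν z) = z := by
      have h : Finsupp.linearCombination k (envelopingWord b p) ∘ₗ ν = .id :=
        linearMap_ext_normalWord (b := b) hp fun D hD => by simp [hν D hD]
      exact DFunLike.congr_fun h z
    have hnormal : ∀ D, ¬ IsNormalWord p D → ν z D = 0 := fun D hD => by
      have h : Finsupp.lapply D ∘ₗ ν = 0 :=
        linearMap_ext_normalWord (b := b) hp fun D' hD' => by
          have hne : D' ≠ D := fun h => hD (h ▸ hD')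
          simp [hν D' hD', hne]
      exact DFunLike.congr_fun h z
    conv_rhs => rw [← hz']
    simp only [π, LinearMap.comp_apply, Finsupp.linearCombination_apply, Finsupp.sum, map_sum,
      map_smul]
    refine Finset.sum_congr rfl fun D _ => ?_
    match D with
    | [] => rw [h0, zero_smul, zero_smul]
    | [i] => simp
    | i :: j :: E =>
      have h : ν z (i :: j :: E) = 0 := by
        by_cases hD : IsNormalWord p (i :: j :: E)
        · exact h2 i j E hD
        · exact hnormal _ hD
      rw [h, zero_smul, zero_smul]

variable (k p L) in
/-- A restricted Lie algebra embeds into its restricted enveloping algebra, with image the space of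
primitive elements. -/
theorem unitHom_bijective :
    Function.Bijective (RestrictedEnveloping.unitHom k p L).toLieHom := by
  classical
  let _ : LinearOrder (Module.Basis.ofVectorSpaceIndex k L) := linearOrderOfSTO WellOrderingRel
  exact unitHom_bijective_of_basis (Module.Basis.ofVectorSpace k L) p

end PrimitiveElements

/-! ### The adjunction and the mate of the identity. -/

/-- The inverse of a bijective morphism of restricted Lie algebras. -/
noncomputable def RestrictedLieHom.inverse {k : Type*} {p : ℕ} {L M : Type*} [Field k] [LieRing L]
    [LieAlgebra k L] [RestrictedLieAlgebra k p L] [LieRing M] [LieAlgebra k M]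
    [RestrictedLieAlgebra k p M] (f : RestrictedLieHom k p L M)
    (hf : Function.Bijective f.toLieHom) : RestrictedLieHom k p M L where
  toLieHom := (LieEquiv.ofBijective f.toLieHom hf).symm
  map_pPow x := by
    let e := LieEquiv.ofBijective f.toLieHom hf
    have h := f.map_pPow (e.symm x)
    have he : ∀ y, f.toLieHom (e.symm y) = y := e.apply_symm_apply
    rw [he] at h
    exact hf.1 (h ▸ he _)

lemma LieP.isIso_of_bijective {k : Type u} [Field k] {p : ℕ} {L M : LieP.{u, v} k p} (f : L ⟶ M)
    (hf : Function.Bijective (RestrictedLieHom.toLieHom f)) : IsIso f := by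
  refine ⟨RestrictedLieHom.inverse f hf, ?_, ?_⟩
  · exact RestrictedLieHom.ext (LieHom.ext fun x =>
      (LieEquiv.ofBijective (RestrictedLieHom.toLieHom f) hf).symm_apply_apply x)
  · exact RestrictedLieHom.ext (LieHom.ext fun x =>
      (LieEquiv.ofBijective (RestrictedLieHom.toLieHom f) hf).apply_symm_apply x)

lemma isIso_envelopingAdjunction_unit_app (k : Type u) [Field k] (p : ℕ) [Fact p.Prime]
    [CharP k p] (L : LieP.{u, max u v} k p) :
    IsIso ((envelopingAdjunction.{u, v} k p).unit.app L) :=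
  LieP.isIso_of_bijective _ (unitHom_bijective k L p)

lemma isIso_envelopingAdjunction_unit (k : Type u) [Field k] (p : ℕ) [Fact p.Prime]
    [CharP k p] : IsIso (envelopingAdjunction.{u, v} k p).unit :=
  have := isIso_envelopingAdjunction_unit_app.{u, v} k p
  NatIso.isIso_of_isIso_app _

/-- On primitive elements of the tensor algebra, the bialgebra morphism `T̃ V → ũ (𝒫 (T̃ V))`
extending `v ↦ v` is the canonical map. -/
lemma zeta_comp_unit {k : Type*} {p : ℕ} [Field k] [Fact p.Prime] [CharP k p] {V : Type*}
    [AddCommGroup V] [Module k V] (x : primitives k (TensorAlgebra k V)) :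
    tensorLift ((RestrictedEnveloping.unitHom k p (primitives k (TensorAlgebra k V))).toLieHom :
        _ →ₗ[k] primitives k (RestrictedEnveloping k p (primitives k (TensorAlgebra k V))))
      (tensorLift (tensorUnit k (primitives k (TensorAlgebra k V)) ∘ₗ tensorUnit k V)
        (x : TensorAlgebra k V)) =
      RestrictedEnveloping.ι k p x := by
  rw [← BialgHom.comp_apply, tensorLift_comp]
  set θ := tensorLift (((RestrictedEnveloping.unitHom k p
    (primitives k (TensorAlgebra k V))).toLieHom :
      _ →ₗ[k] primitives k (RestrictedEnveloping k p (primitives k (TensorAlgebra k V)))) ∘ₗ tensorUnit k V)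
  let ε := RestrictedEnveloping.bialgLift
    (RestrictedLieHom.id k p (primitives k (TensorAlgebra k V)))
  have hε : ∀ y, ε (RestrictedEnveloping.ι k p y) = y :=
    RestrictedEnveloping.bialgLift_ι (RestrictedLieHom.id k p _)
  have hεθ : ε.comp θ = BialgHom.id k (TensorAlgebra k V) :=
    tensor_bialgHom_ext fun v => by
      rw [BialgHom.comp_apply, tensorLift_ι]
      exact hε (tensorUnit k V v)
  -- Bialgebra morphisms preserve primitives, so surjectivity of the unit applies to `θ x`; the
  -- retraction `ε` then identifies `y`.
  obtain ⟨y, hy⟩ := (unitHom_bijective k (primitives k (TensorAlgebra k V)) p).2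
    (primitivesMap θ x)
  have hy' : RestrictedEnveloping.ι k p y = θ x := congrArg Subtype.val hy
  have hyx : (y : TensorAlgebra k V) = x := by
    rw [← hε y, hy', ← BialgHom.comp_apply, hεθ]
    rfl
  rw [← hy', Subtype.ext hyx]

lemma forgetLieP_map_inv {k : Type u} [Field k] {p : ℕ} {L M : LieP.{u, v} k p} (f : L ⟶ M)
    [IsIso f] (x : L) :
    RestrictedLieHom.toLieHom (inv f) (RestrictedLieHom.toLieHom f x) = x :=
  DFunLike.congr_fun (congrArg RestrictedLieHom.toLieHom (IsIso.hom_inv_id f)) x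

attribute [local instance] isIso_envelopingAdjunction_unit_app isIso_envelopingAdjunction_unit in
/-- The adjunction `𝒫 T̃ ⊣ H`. -/
noncomputable def freeRestrictedLieAdjunction (k : Type u) [Field k] (p : ℕ) [Fact p.Prime]
    [CharP k p] : tensorFunctor.{u, max u v} k ⋙ primitiveFunctor.{u, max u v} k p ⊣
      forgetLieP.{u, max u v} k p where
  unit := (tensorAdjunction.{u, v} k).unit
  counit := Functor.whiskerRight (zetaOneOne.{u, max u v} k p) (primitiveFunctor k p) ≫
    inv (envelopingAdjunction.{u, v} k p).unit
  left_triangle_components V := by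
    rw [NatTrans.comp_app, NatIso.isIso_inv_app, ← Category.assoc, IsIso.comp_inv_eq,
      Category.id_comp]
    exact RestrictedLieHom.ext (LieHom.ext fun x => Subtype.ext (zeta_comp_unit (p := p) x))
  right_triangle_components L := by
    rw [NatTrans.comp_app, NatIso.isIso_inv_app]
    refine ModuleCat.hom_ext (LinearMap.ext fun x => ?_)
    have h := forgetLieP_map_inv ((envelopingAdjunction.{u, v} k p).unit.app L) x
    refine Eq.trans (congrArg (RestrictedLieHom.toLieHom
      (inv ((envelopingAdjunction.{u, v} k p).unit.app L))) (Subtype.ext ?_)) h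
    exact tensorLift_ι _ x

lemma mate_zetaOneOne_app (k : Type u) [Field k] (p : ℕ) [Fact p.Prime] [CharP k p]
    (B : BialgCat.{max u v} k) :
    (mateEquiv (envelopingAdjunction.{u, v} k p) (tensorAdjunction.{u, v} k)
        (TwoSquare.mk _ _ _ (𝟭 _) (zetaOneOne.{u, max u v} k p ≫
          (envelopingFunctor.{u, max u v} k p).rightUnitor.inv))).natTrans.app B =
      (tensorAdjunction.{u, v} k).unit.app ((primitiveSpaceFunctor k).obj B) ≫
        (primitiveSpaceFunctor k).map ((zetaOneOne.{u, max u v} k p).app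
          ((primitiveFunctor k p).obj B)) ≫
        (primitiveSpaceFunctor k).map ((envelopingAdjunction.{u, v} k p).counit.app B) := by
  simp only [mateEquiv_apply, NatTrans.comp_app, Functor.whiskerLeft_app, Functor.whiskerRight_app,
    Functor.associator_hom_app, Functor.associator_inv_app, Functor.rightUnitor_inv_app,
    Functor.leftUnitor_hom_app, Category.id_comp, Category.comp_id]
  rfl

lemma bialgLift_tensorLift_ι {k : Type*} (p : ℕ) [Field k] [Fact p.Prime] [CharP k p] {B : Type*}
    [Ring B] [Bialgebra k B] (x : primitives k B) :
    RestrictedEnveloping.bialgLift (RestrictedLieHom.id k p (primitives k B))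
      (tensorLift ((RestrictedEnveloping.unitHom k p (primitives k B)).toLieHom :
        _ →ₗ[k] primitives k (RestrictedEnveloping k p (primitives k B)))
        (TensorAlgebra.ι k x)) = x := by
  rw [tensorLift_ι]
  exact RestrictedEnveloping.bialgLift_ι _ x

/-- A primitive `x` goes to the generator `x` of the tensor algebra, then to the generator `x` of
the enveloping algebra, and the counit evaluates it back in `B`. -/
lemma unit_zeta_counit (k : Type u) [Field k] (p : ℕ) [Fact p.Prime] [CharP k p]
    (B : BialgCat.{max u v} k) :
    (tensorAdjunction.{u, v} k).unit.app ((primitiveSpaceFunctor k).obj B) ≫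
        (primitiveSpaceFunctor k).map ((zetaOneOne.{u, max u v} k p).app
          ((primitiveFunctor k p).obj B)) ≫
        (primitiveSpaceFunctor k).map ((envelopingAdjunction.{u, v} k p).counit.app B) =
      𝟙 ((primitiveSpaceFunctor.{u, max u v} k).obj B) := by
  refine ModuleCat.hom_ext (LinearMap.ext fun x => Subtype.ext ?_)
  exact bialgLift_tensorLift_ι p x

end RestrictedLie

/-- For a field `k` of prime characteristic `p`, the functor `𝒫 T̃` is left adjoint to the forgetful
functor `H : Lie_p ⥤ Vect`, with unit `η̃` and counit `η̃_L⁻¹ ∘ 𝒫 ζ₁₁`. -/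
theorem mainTheorem2 (k : Type u) [Field k] (p : ℕ) [Fact p.Prime] [CharP k p] :
    -- the explicit description of `𝒫 T̃ V`
    (∀ V : ModuleCat.{max u v} k,
      (tensorFunctor.{u, max u v} k ⋙ primitiveFunctor.{u, max u v} k p).obj V =
          LieP.mk (primitives k (TensorAlgebra k V)) ∧
        (∀ x y : primitives k (TensorAlgebra k V),
          ((⁅x, y⁆ : primitives k (TensorAlgebra k V)) : TensorAlgebra k V) =
            (x : TensorAlgebra k V) * y - (y : TensorAlgebra k V) * x) ∧
        ∀ x : primitives k (TensorAlgebra k V),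
          ((pPow k p x : primitives k (TensorAlgebra k V)) : TensorAlgebra k V) =
            (x : TensorAlgebra k V) ^ p) ∧
    -- `H 𝒫 = P`, and `ζ₁₁` is the transpose of the identity of `H 𝒫 = P`
    primitiveFunctor.{u, max u v} k p ⋙ forgetLieP.{u, max u v} k p =
      primitiveSpaceFunctor.{u, max u v} k ∧
    (∀ B : BialgCat.{max u v} k,
      (mateEquiv (envelopingAdjunction.{u, v} k p) (tensorAdjunction.{u, v} k)
        (TwoSquare.mk _ _ _ (𝟭 _) (zetaOneOne.{u, max u v} k p ≫
          (envelopingFunctor.{u, max u v} k p).rightUnitor.inv))).natTrans.app B =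
        𝟙 ((primitiveSpaceFunctor.{u, max u v} k).obj B)) ∧
    -- the unit of `ũ ⊣ 𝒫` is invertible, and `𝒫 T̃ ⊣ H` with the stated unit and counit
    (∃ _ : IsIso (envelopingAdjunction.{u, v} k p).unit,
      ∃ adj : tensorFunctor.{u, max u v} k ⋙ primitiveFunctor.{u, max u v} k p ⊣
          forgetLieP.{u, max u v} k p,
        (∀ V : ModuleCat.{max u v} k,
          adj.unit.app V = (tensorAdjunction.{u, v} k).unit.app V) ∧
        ∀ L : LieP.{u, max u v} k p,
          adj.counit.app L =
            (primitiveFunctor.{u, max u v} k p).map ((zetaOneOne.{u, max u v} k p).app L) ≫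
              inv ((envelopingAdjunction.{u, v} k p).unit.app L)) ∧
    -- `𝒫 T̃ V` is the free restricted Lie algebra on `V`
    (∀ (V : ModuleCat.{max u v} k) (L : LieP.{u, max u v} k p) (f : V →ₗ[k] L),
      ∃! g : RestrictedLieHom k p (primitives k (TensorAlgebra k V)) L,
        ∀ v : V, g.toLieHom ⟨TensorAlgebra.ι k v, ι_mem_primitives k v⟩ = f v) := by
  refine ⟨fun V => ⟨rfl, fun x y => rfl, fun x => rfl⟩, rfl, fun B => ?_,
    ⟨isIso_envelopingAdjunction_unit.{u, v} k p, freeRestrictedLieAdjunction k p, fun V => rfl, fun L => ?_⟩, fun V L f => ?_⟩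
  · exact (mate_zetaOneOne_app.{u, v} k p B).trans (unit_zeta_counit.{u, v} k p B)
  · have := isIso_envelopingAdjunction_unit.{u, v} k p
    -- The counit was built from the inverse natural transformation, whereas the claim inverts the
    -- component at `L`.
    change (_ ≫ (inv (envelopingAdjunction.{u, v} k p).unit).app L) = _
    rw [NatIso.isIso_inv_app]
    rfl
  · let adj := freeRestrictedLieAdjunction.{u, v} k p
    let e := adj.homEquiv V L
    have he : ∀ g : (tensorFunctor k ⋙ primitiveFunctor k p).obj V ⟶ L,
        e g = ModuleCat.ofHom f ↔
          ∀ v : V, RestrictedLieHom.toLieHom g ⟨TensorAlgebra.ι k v, ι_mem_primitives k v⟩ = f v := by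
      intro g
      rw [adj.homEquiv_unit]
      constructor
      · intro h v
        exact DFunLike.congr_fun (congrArg ModuleCat.Hom.hom h) v
      · intro h
        exact ModuleCat.hom_ext (LinearMap.ext h)
    refine ⟨e.symm (ModuleCat.ofHom f), (he _).1 (e.apply_symm_apply _), fun g hg => ?_⟩
    exact e.eq_symm_apply.2 ((he g).2 hg)
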